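/- Let $d=2^b$ with an integer $b\ge 0$, let $p=d^2=4^b$, and let $B_1,\dots,B_p$ be the Pauli basis, i.e. all tensor products $\sigma_{\ell_1}\otimes\cdots\otimes\sigma_{\ell_b}$, $(\ell_1,\dots,\ell_b)\in\{0,1,2,3\}^b$, of the $2\times2$ identity $\sigma_0$ and the Pauli matrices $\sigma_1,\sigma_2,\sigma_3$. Write $B_j=\sum_{a=1}^{r_j}\lambda_{ja}Q_{ja}$ with distinct eigenvalues $\lambda_{ja}$ and eigenprojections $Q_{ja}$. A density matrix is a positive semidefinite Hermitian matrix with trace $1$; $\Theta_s^p$ denotes the class of all $d\times d$ density matrices $\rho=\sum_j\alpha_jB_j$ with at most $s$ nonzero coefficients $\alpha_j$. For a density matrix $\rho$ let $I_j(\rho)=\{a: 0<\operatorname{tr}(Q_{ja}\rho)<1\}$. (1) Let $s\ge1$. For a class $\Theta$ of density matrices and sampling distributions $\Pi,\Xi$ on $\{1,\dots,p\}$ put $\zeta_p=\max_{\rho\in\Theta}\max\{\sum_j\Pi(j)1(|I_j(\rho)|\ge2),\ \sum_j\Xi(j)1(|I_j(\rho)|\ge2)\}$. For $\Theta=\Theta_s^p$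 and $\Pi(j)=\Xi(j)=1/p$, $$1\ \ge\ \zeta_p=\max_{\rho\in\Theta_s^p}\Big\{\frac1p\sum_{j=1}^p1\big(|I_j(\rho)|\ge2\big)\Big\}\ \ge\ 1-\frac1p .$$ (2) For all constants $0<c_0\le c_1<1$ there is a constant $C>0$, depending only on $c_0,c_1$, such that the following holds for all $b\ge0$, all integers $s,n\ge0$ and $m\ge1$, and every class $\Theta\subseteq\Theta^p_s$ such that $c_0\le\operatorname{tr}(Q_{ja}\rho)\le c_1$ for all $\rho\in\Theta$, all $j$ and all $a\in I_j(\rho)$. Consider the following four statistical experiments with parameter $\rho\in\Theta$, in each of which one observes $n$ independent copies: - $\mathcal P_{1n}$ (trace regression): $(X,Y)$ with $X$ uniform on $\{B_1,\dots,B_p\}$ and, given $X$, $Y\sim N\big(\operatorname{tr}(X\rho),\ \tfrac1m\{\operatorname{tr}(X^2\rho)-[\operatorname{tr}(X\rho)]^2\}\big)$; - $\mathcal P_{2n}$ (quantum state tomography, summarized measurements): $(M,N)$ with $M$ uniform on $\{B_1,\dots,B_p\}$ and, given $M=B_j$, $N=(R_1+\cdots+R_m)/m$, where $R_1,\dots,R_m$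 are i.i.d. with $P(R_\ell=\lambda_{ja})=\operatorname{tr}(Q_{ja}\rho)$; - $\mathcal Q_{1n}$ (fine scale trace regression): $(X,(y_a)_{a})$ with $X$ uniform on $\{B_1,\dots,B_p\}$ and, given $X=B_j$, $(y_a)_{1\le a\le r_j}$ multivariate normal with means $\operatorname{tr}(Q_{ja}\rho)$, variances $\tfrac1m\operatorname{tr}(Q_{ja}\rho)[1-\operatorname{tr}(Q_{ja}\rho)]$ and covariances $-\tfrac1m\operatorname{tr}(Q_{ja}\rho)\operatorname{tr}(Q_{ja'}\rho)$ for $a\ne a'$; - $\mathcal Q_{2n}$ (quantum state tomography, individual measurements): $(M,R_1,\dots,R_m)$ with $M,R_1,\dots,R_m$ as in $\mathcal P_{2n}$. Then $$\Delta(\mathcal P_{1n},\mathcal P_{2n})\le C\Big(\frac nm\Big)^{1/2},\qquad \Delta(\mathcal Q_{1n},\mathcal Q_{2n})\le C\Big(\frac nm\Big)^{1/2}.$$ Here $\Delta(\mathcal E_1,\mathcal E_2)=\max\{\delta(\mathcal E_1,\mathcal E_2),\delta(\mathcal E_2,\mathcal E_1)\}$ is Le Cam's deficiency distance, with $\delta(\mathcal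 E_1,\mathcal E_2)=\sup_{A,\chi_2}\inf_{\chi_1}\sup_{\rho\in\Theta}\sup_{L}|R_1(\chi_1,L,\rho)-R_2(\chi_2,L,\rho)|$, where $A$ ranges over measurable action spaces, $\chi_i$ over the (randomized) decision procedures in $\mathcal E_i$ with values in $A$, $L$ over the loss functions $L:\Theta\times A\to[0,\infty)$ that are measurable in the action and have $\sup L=1$, and $R_i(\chi_i,L,\rho)$ is the risk of $\chi_i$. -/

import Mathlib

open MeasureTheory ProbabilityTheory
open scoped ENNReal NNReal ComplexOrder

noncomputable section

namespace Tomography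

/-! ### Density matrices, observables and their measurement -/

section Quantum

variable {ι : Type} [Fintype ι] [DecidableEq ι]

/-- Density matrices: positive semidefinite (in particular Hermitian) with unit trace. -/
def IsDensity (ρ : Matrix ι ι ℂ) : Prop :=
  ρ.PosSemidef ∧ ρ.trace = 1

/-- The finite set of (real) eigenvalues of a square matrix, that is, the possible outcomes of
a measurement of the observable `B`. -/
def outcomes (B : Matrix ι ι ℂ) : Finset ℝ :=
  (Matrix.finite_real_spectrum (A := B)).toFinset

/-- The matrix of the orthogonal projection of `ℂ^ι` onto the eigenspace of `B` for `x`. -/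
def eigenProj (B : Matrix ι ι ℂ) (x : ℝ) : Matrix ι ι ℂ :=
  (Matrix.toEuclideanCLM (n := ι) (𝕜 := ℂ)).symm
    (Module.End.eigenspace (Matrix.toEuclideanLin B) (x : ℂ)).starProjection

/-- The probability `tr (Q ρ)` of the outcome `x` when `B` is measured in the state `ρ`, where
`Q` is the projection onto the eigenspace of `B` for `x`. -/
def outcomeProb (B ρ : Matrix ι ι ℂ) (x : ℝ) : ℝ :=
  (eigenProj B x * ρ).trace.re

/-- The set `I(ρ)` of the eigenvalues of `B` whose probability under `ρ` is strictly between
`0` and `1`. Distinct eigenvalues are indexed by their values. -/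
def properOutcomes (B ρ : Matrix ι ι ℂ) : Finset ℝ :=
  {x ∈ outcomes B | 0 < outcomeProb B ρ x ∧ outcomeProb B ρ x < 1}

/-- The law of one measurement of the observable `B` in the state `ρ`. -/
def outcomeLaw (B ρ : Matrix ι ι ℂ) : Measure ℝ :=
  ∑ x ∈ outcomes B, ENNReal.ofReal (outcomeProb B ρ x) • Measure.dirac x

end Quantum

/-! ### The Pauli basis -/

/-- The `2 × 2` identity matrix and the three Pauli matrices. -/
def sigma : Fin 4 → Matrix (Fin 2) (Fin 2) ℂ :=
  ![!![1, 0; 0, 1],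
    !![0, 1; 1, 0],
    !![0, -Complex.I; Complex.I, 0],
    !![1, 0; 0, -1]]

/-- The index set `{0, 1, 2, 3}^b` of the Pauli basis; it has `p = 4^b` elements. -/
abbrev PauliIndex (b : ℕ) : Type := Fin b → Fin 4

/-- The index set of the rows and columns of a `2^b × 2^b` matrix. -/
abbrev QubitIndex (b : ℕ) : Type := Fin b → Fin 2

/-- The `b`-fold tensor (Kronecker) product `σ_{ℓ 0} ⊗ ⋯ ⊗ σ_{ℓ (b - 1)}`. -/
def pauli (b : ℕ) (l : PauliIndex b) : Matrix (QubitIndex b) (QubitIndex b) ℂ :=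
  Matrix.of fun x y => ∏ i, sigma (l i) (x i) (y i)

/-- The class of all `2^b × 2^b` density matrices that are `s`-sparse under the Pauli basis. -/
def sparsePauli (b s : ℕ) : Set (Matrix (QubitIndex b) (QubitIndex b) ℂ) :=
  {ρ | IsDensity ρ ∧ ∃ α : PauliIndex b → ℂ,
    ρ = ∑ l, α l • pauli b l ∧ (Finset.univ.filter fun l => α l ≠ 0).card ≤ s}

/-! ### The models

`B` is a finite family of observables, and `Π`, `Ξ` are sampling distributions on its index set;
a sampled matrix is recorded through its index. -/

section Models

variable {ι J : Type} [Fintype ι] [DecidableEq ι] [Fintype J] [MeasurableSpace J]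

/-- The constant `ζ_p`: the maximum over `ρ ∈ Θ` of the `Π`- and the `Ξ`-probability of
drawing an observable whose measurement in the state `ρ` is not deterministic. -/
def zeta (Θ : Set (Matrix ι ι ℂ)) (B : J → Matrix ι ι ℂ) (Pi Xi : PMF J) : ℝ :=
  sSup ((fun ρ => max
    (∑ j, (Pi j).toReal * if 2 ≤ (properOutcomes (B j) ρ).card then 1 else 0)
    (∑ j, (Xi j).toReal * if 2 ≤ (properOutcomes (B j) ρ).card then 1 else 0)) '' Θ)

/-- The condition that for `ρ ∈ Θ` all outcome probabilities strictly between `0` and `1` lie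
in `[c₀, c₁]`. -/
def ProbsBounded (Θ : Set (Matrix ι ι ℂ)) (B : J → Matrix ι ι ℂ) (c₀ c₁ : ℝ) : Prop :=
  ∀ ρ ∈ Θ, ∀ j, ∀ x ∈ properOutcomes (B j) ρ,
    c₀ ≤ outcomeProb (B j) ρ x ∧ outcomeProb (B j) ρ x ≤ c₁

/-- Trace regression with random design: `n` independent copies of `(X, Y)`, where `X = B j`
with probability `Π j`, and `Y = tr (X ρ) + ε` with `ε` normal with mean zero and variance
`(tr (X² ρ) - (tr (X ρ))²) / m` given `X`. -/
def traceRegression (B : J → Matrix ι ι ℂ) (Pi : PMF J) (n m : ℕ) (ρ : Matrix ι ι ℂ) :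
    Measure (Fin n → J × ℝ) :=
  Measure.pi fun _ => ∑ j, Pi j •
    (gaussianReal (B j * ρ).trace.re
      (Real.toNNReal (((B j * B j * ρ).trace.re - (B j * ρ).trace.re ^ 2) / m))).map (Prod.mk j)

/-- Quantum state tomography with summarized measurements: `n` independent copies of `(M, N)`,
where `M = B j` with probability `Ξ j`, and given `M`, `N` is the average of `m` independent
measurements of `M` in the state `ρ`. -/
def tomographySummarized (B : J → Matrix ι ι ℂ) (Xi : PMF J) (n m : ℕ) (ρ : Matrix ι ι ℂ) :
    Measure (Fin n → J × ℝ) :=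
  Measure.pi fun _ => ∑ j, Xi j •
    ((Measure.pi fun _ : Fin m => outcomeLaw (B j) ρ).map
      fun r : Fin m → ℝ => (∑ i, r i) / (m : ℝ)).map (Prod.mk j)

/-- The covariance matrix with entries `p_x (1 - p_x) / m` on the diagonal and `- p_x p_y / m`
off the diagonal, where `p_x = tr (Q_x ρ)`. -/
def fineCov (B ρ : Matrix ι ι ℂ) (m : ℕ) : Matrix (outcomes B) (outcomes B) ℝ :=
  Matrix.of fun x y =>
    if x = y then outcomeProb B ρ x * (1 - outcomeProb B ρ x) / m
    else -(outcomeProb B ρ x * outcomeProb B ρ y) / m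

/-- Fine scale trace regression with random design: `n` independent copies of `(X, y)`, where
`X = B j` with probability `Π j`, and given `X`, the vector `y`, indexed by the distinct
eigenvalues of `X`, has entries `y_x = tr (Q_x ρ) + z_x` with `z` centred multivariate normal with
covariance matrix `fineCov`. -/
def fineTraceRegression (B : J → Matrix ι ι ℂ) (Pi : PMF J) (n m : ℕ) (ρ : Matrix ι ι ℂ) :
    Measure (Fin n → Σ j : J, EuclideanSpace ℝ (outcomes (B j))) :=
  Measure.pi fun _ => ∑ j, Pi j •
    (multivariateGaussian (WithLp.toLp 2 fun x : outcomes (B j) => outcomeProb (B j) ρ x)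
      (fineCov (B j) ρ m)).map
      (Sigma.mk (β := fun j : J => EuclideanSpace ℝ (outcomes (B j))) j)

/-- Quantum state tomography with individual measurements: `n` independent copies of
`(M, R_1, …, R_m)`, where `M = B j` with probability `Ξ j`, and given `M`, `R_1, …, R_m` are
independent measurements of `M` in the state `ρ`. -/
def tomographyIndividual (B : J → Matrix ι ι ℂ) (Xi : PMF J) (n m : ℕ) (ρ : Matrix ι ι ℂ) :
    Measure (Fin n → J × (Fin m → ℝ)) :=
  Measure.pi fun _ => ∑ j, Xi j •
    (Measure.pi fun _ : Fin m => outcomeLaw (B j) ρ).map (Prod.mk j)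

end Models

/-! ### Le Cam's deficiency distance

A statistical experiment with parameter set `T` and sample space `X` is a family
`P : T → Measure X`. -/

/-- Loss functions `L : T × A → [0, ∞)`, measurable in the action, with `‖L‖ = sup L = 1`. -/
structure Loss (T A : Type) [MeasurableSpace A] where
  /-- the underlying function -/
  toFun : T → A → ℝ
  nonneg : ∀ t a, 0 ≤ toFun t a
  measurable : ∀ t, Measurable (toFun t)
  sup_eq_one : IsLUB (Set.range fun q : T × A => toFun q.1 q.2) 1

/-- (Randomized) decision procedures: Markov kernels from the sample space to the actions. -/
def Procedure (X A : Type) [MeasurableSpace X] [MeasurableSpace A] : Type :=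
  {χ : Kernel X A // IsMarkovKernel χ}

/-- The risk `R(χ, L, t)` of the procedure `χ` for the loss `L` at the parameter `t`. -/
def risk {T X A : Type} [MeasurableSpace X] [MeasurableSpace A] (P : T → Measure X)
    (χ : Procedure X A) (L : Loss T A) (t : T) : ℝ :=
  ∫ x, ∫ a, L.toFun t a ∂(χ.1 x) ∂(P t)

/-- The deficiency `δ(P, Q)` of `P` with respect to `Q`: the least `ε` such that for every `ε' > ε`
and every action space, each procedure in the experiment `Q` has a corresponding procedure in `P`
whose risk, for all losses with `‖L‖ = 1` and all parameters, differs from its risk by at most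
`ε'`. -/
def deficiency {T X Y : Type} [MeasurableSpace X] [MeasurableSpace Y]
    (P : T → Measure X) (Q : T → Measure Y) : ℝ≥0∞ :=
  ⨆ (A : Type) (_ : MeasurableSpace A) (χ₂ : Procedure Y A),
    ⨅ χ₁ : Procedure X A, ⨆ (t : T) (L : Loss T A),
      ENNReal.ofReal |risk P χ₁ L t - risk Q χ₂ L t|

/-- Le Cam's deficiency distance `Δ(P, Q) = max (δ(P, Q)) (δ(Q, P))`. -/
def deficiencyDist {T X Y : Type} [MeasurableSpace X] [MeasurableSpace Y]
    (P : T → Measure X) (Q : T → Measure Y) : ℝ≥0∞ :=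
  max (deficiency P Q) (deficiency Q P)

end Tomography

end

open Tomography

/-! Every Pauli matrix `B` is a Hermitian involution, so its only possible outcomes are `1` and
`-1`, and its measurement in the state `ρ` is governed by one number, `θ = (1 + tr (B ρ)) / 2`, the
probability of `1`.

The statement on `ζ_p` is witnessed by the maximally mixed state: it is a multiple of the identity
Pauli matrix, and all other Pauli matrices have trace zero, hence `θ = 1/2`. The supremum is
attained because the fraction takes finitely many values.

For the deficiency bounds, the average of `m` measurements is `2 K / m - 1` with `K` binomial,
whereas the trace regression response is normal with the same mean `2 θ - 1` and the same variance
`4 θ (1 - θ) / m`. Uniform noise spreads each interior atom of the average over a cell of length `2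
/ m`; rounding undoes this exactly. Stirling's formula bounds the squared logarithm of the ratio of
the two densities by a constant times `(1 + (m (k/m - θ) ^ 2) ^ 3) / m`. Sixth moments then give
Hellinger affinity at least `1 - C / m` (`exists_hasAffinity_smoothed_binomial`). If `θ` is `0` or
`1`, both laws are the same point mass.

Affinity does not deteriorate under mixing over the sampled observable (`HasAffinity.sum`), so `C`
does not depend on `b`. It multiplies over the `n` copies, and affinity `(1 - C / m) ^ n` leaves a
common part of mass at least `1 - √(2 n C / m)` (`HasAffinity.overlaps_pi`). Adding up total
variation distances over the copies would give only the order `n / √m`. A common part of this mass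
after a Markov kernel bounds the deficiency (`deficiency_le`).

The fine scale pair reduces to the coarse pair without loss. The average is sufficient for the
individual outcomes, which a uniformly random permutation restores (`map_disperse`). The fine scale
normal vector has a covariance of rank at most one and is an affine image of the scalar response
(`map_refineResponse`). -/

noncomputable section

namespace Tomography

/-! ### Overlap of two measures and deficiency -/

section Overlap

/-- The measures `P` and `Q` have a common part of mass at least `1 - ε`. For probability measures
this means that their total variation distance is at most `ε`. -/
def Overlaps {X : Type*} [MeasurableSpace X] (P Q : Measure X) (ε : ℝ) : Prop :=
  ∃ R : Measure X, R ≤ P ∧ R ≤ Q ∧ 1 - ε ≤ R.real Set.univ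

variable {X Y Z : Type*} [MeasurableSpace X] [MeasurableSpace Y] [MeasurableSpace Z]

theorem Overlaps.symm {P Q : Measure X} {ε : ℝ} (h : Overlaps P Q ε) : Overlaps Q P ε := by
  obtain ⟨R, hP, hQ, hR⟩ := h
  exact ⟨R, hQ, hP, hR⟩

theorem Overlaps.mono {P Q : Measure X} {ε ε' : ℝ} (h : Overlaps P Q ε) (hε : ε ≤ ε') :
    Overlaps P Q ε' := by
  obtain ⟨R, hP, hQ, hR⟩ := h
  exact ⟨R, hP, hQ, by linarith⟩

theorem overlaps_of_one_le (P Q : Measure X) {ε : ℝ} (h : 1 ≤ ε) : Overlaps P Q ε :=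
  ⟨0, Measure.zero_le _, Measure.zero_le _, by simpa using h⟩

theorem comp_le_comp (κ : Kernel X Y) {P Q : Measure X} (h : P ≤ Q) : κ ∘ₘ P ≤ κ ∘ₘ Q := by
  refine Measure.le_iff.2 fun s hs => ?_
  rw [Measure.bind_apply hs κ.aemeasurable, Measure.bind_apply hs κ.aemeasurable]
  exact lintegral_mono' h le_rfl

theorem Overlaps.comp {P Q : Measure X} {ε : ℝ} (h : Overlaps P Q ε) (κ : Kernel X Y)
    [IsMarkovKernel κ] : Overlaps (κ ∘ₘ P) (κ ∘ₘ Q) ε := by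
  obtain ⟨R, hP, hQ, hR⟩ := h
  refine ⟨κ ∘ₘ R, comp_le_comp κ hP, comp_le_comp κ hQ, ?_⟩
  have : (κ ∘ₘ R) Set.univ = R Set.univ := by
    rw [Measure.bind_apply .univ κ.aemeasurable]
    simp
  rwa [measureReal_def, this]

theorem integral_sub_le_of_le {P R : Measure X} [IsProbabilityMeasure P] {ε : ℝ} (hRP : R ≤ P)
    (hR : 1 - ε ≤ R.real Set.univ) {f : X → ℝ} (hf : Measurable f)
    (h0 : ∀ x, 0 ≤ f x) (h1 : ∀ x, f x ≤ 1) :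
    0 ≤ (∫ x, f x ∂P) - ∫ x, f x ∂(R) ∧ (∫ x, f x ∂P) - ∫ x, f x ∂(R) ≤ ε := by
  have : IsFiniteMeasure R := ⟨(hRP Set.univ).trans_lt (measure_lt_top P _)⟩
  have hint : ∀ (S : Measure X) [IsFiniteMeasure S], Integrable f S := fun S _ =>
    Integrable.of_bound hf.aestronglyMeasurable 1
      (ae_of_all _ fun x => by rw [Real.norm_eq_abs, abs_of_nonneg (h0 x)]; exact h1 x)
  have hsub : P - R + R = P := Measure.sub_add_cancel_of_le hRP
  have hP : ∫ x, f x ∂P = (∫ x, f x ∂(P - R)) + ∫ x, f x ∂(R) := by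
    conv_lhs => rw [← hsub]
    exact integral_add_measure (hint _) (hint _)
  have hmass : (P - R).real Set.univ + R.real Set.univ = 1 := by
    rw [← measureReal_add_apply, hsub, probReal_univ]
  have hle : ∫ x, f x ∂(P - R) ≤ (P - R).real Set.univ := by
    calc ∫ x, f x ∂(P - R) ≤ ∫ _, (1 : ℝ) ∂(P - R) :=
          integral_mono (hint _) (integrable_const _) h1
      _ = _ := by simp
  have hnn : 0 ≤ ∫ x, f x ∂(P - R) := integral_nonneg h0
  constructor <;> linarith

/-- Both integrals lie between `∫ f dR` and `∫ f dR + ε` for the common part `R`, so the loss is `ε`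
and not `2 ε`. -/
theorem Overlaps.abs_integral_sub_le {P Q : Measure X} [IsProbabilityMeasure P]
    [IsProbabilityMeasure Q] {ε : ℝ} (h : Overlaps P Q ε) {f : X → ℝ} (hf : Measurable f)
    (h0 : ∀ x, 0 ≤ f x) (h1 : ∀ x, f x ≤ 1) : |(∫ x, f x ∂P) - ∫ x, f x ∂Q| ≤ ε := by
  obtain ⟨R, hP, hQ, hR⟩ := h
  have a := integral_sub_le_of_le hP hR hf h0 h1
  have b := integral_sub_le_of_le hQ hR hf h0 h1
  rw [abs_le]
  constructor <;> linarith [a.1, a.2, b.1, b.2]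

end Overlap

/-! ### Bounding the deficiency by means of a Markov kernel -/

section Deficiency

variable {T X Y Z : Type} [MeasurableSpace X] [MeasurableSpace Y] [MeasurableSpace Z]

theorem Loss.le_one {A : Type} [MeasurableSpace A] (L : Loss T A) (t : T) (a : A) :
    L.toFun t a ≤ 1 :=
  L.sup_eq_one.1 ⟨(t, a), rfl⟩

/-- A procedure `χ₂` is imitated by applying `κ` first. Both risks then integrate the same function
of `y`, the expected loss under `χ₂`, which has values in `[0, 1]`. -/
theorem deficiency_le {P : T → Measure X} {Q : T → Measure Y} [∀ t, IsProbabilityMeasure (P t)]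
    [∀ t, IsProbabilityMeasure (Q t)] (κ : Kernel X Y) [IsMarkovKernel κ] {ε : ℝ}
    (h : ∀ t, Overlaps (κ ∘ₘ P t) (Q t) ε) : deficiency P Q ≤ ENNReal.ofReal ε := by
  refine iSup_le fun A => iSup_le fun _ => iSup_le fun χ₂ => ?_
  have := χ₂.2
  refine iInf_le_of_le ⟨χ₂.1 ∘ₖ κ, inferInstance⟩ ?_
  refine iSup_le fun t => iSup_le fun L => ENNReal.ofReal_le_ofReal ?_
  have hint : ∀ (S : Measure A) [IsFiniteMeasure S], Integrable (L.toFun t) S := fun S _ =>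
    Integrable.of_bound (L.measurable t).aestronglyMeasurable 1
      (ae_of_all _ fun a => by
        rw [Real.norm_eq_abs, abs_of_nonneg (L.nonneg t a)]; exact L.le_one t a)
  have hmeas : Measurable fun y => ∫ a, L.toFun t a ∂(χ₂.1 y) :=
    (StronglyMeasurable.integral_kernel (L.measurable t).stronglyMeasurable).measurable
  have h0 : ∀ y, 0 ≤ ∫ a, L.toFun t a ∂(χ₂.1 y) := fun y => integral_nonneg (L.nonneg t)
  have h1 : ∀ y, ∫ a, L.toFun t a ∂(χ₂.1 y) ≤ 1 := fun y => by
    calc ∫ a, L.toFun t a ∂(χ₂.1 y) ≤ ∫ _, (1 : ℝ) ∂(χ₂.1 y) :=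
          integral_mono (hint _) (integrable_const _) (L.le_one t)
      _ = 1 := by simp
  have hrisk : risk P ⟨χ₂.1 ∘ₖ κ, inferInstance⟩ L t =
      ∫ y, ∫ a, L.toFun t a ∂(χ₂.1 y) ∂(κ ∘ₘ P t) := by
    have hg : Integrable (fun y => ∫ a, L.toFun t a ∂(χ₂.1 y)) (κ ∘ₘ P t) :=
      Integrable.of_bound hmeas.aestronglyMeasurable 1
        (ae_of_all _ fun y => by rw [Real.norm_eq_abs, abs_of_nonneg (h0 y)]; exact h1 y)
    rw [Measure.comp_eq_comp_const_apply] at hg ⊢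
    rw [Kernel.integral_comp hg]
    refine integral_congr_ae (ae_of_all _ fun x => ?_)
    exact Kernel.integral_comp (hint _)
  rw [hrisk]
  exact (h t).abs_integral_sub_le hmeas h0 h1

end Deficiency

/-! ### Affinity -/

section Affinity

/-- `P` and `Q` dominate measures `τ.withDensity f` and `τ.withDensity g` whose Hellinger affinity
`∫ √(f g) dτ` is at least `a`. -/
def HasAffinity {X : Type*} [MeasurableSpace X] (P Q : Measure X) (a : ℝ≥0∞) : Prop :=
  ∃ τ : Measure X, SFinite τ ∧ ∃ f g : X → ℝ≥0, Measurable f ∧ Measurable g ∧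
    τ.withDensity (fun x => f x) ≤ P ∧ τ.withDensity (fun x => g x) ≤ Q ∧
    a ≤ ∫⁻ x, NNReal.sqrt (f x * g x) ∂τ

variable {X Y Z : Type*} [MeasurableSpace X] [MeasurableSpace Y] [MeasurableSpace Z]

theorem HasAffinity.mono {P Q : Measure X} {a b : ℝ≥0∞} (h : HasAffinity P Q a) (hb : b ≤ a) :
    HasAffinity P Q b := by
  obtain ⟨τ, hτ, f, g, hf, hg, hP, hQ, ha⟩ := h
  exact ⟨τ, hτ, f, g, hf, hg, hP, hQ, hb.trans ha⟩

theorem HasAffinity.refl (P : Measure X) [IsProbabilityMeasure P] : HasAffinity P P 1 := by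
  refine ⟨P, inferInstance, 1, 1, measurable_one, measurable_one, ?_, ?_, ?_⟩ <;> simp

theorem HasAffinity.map {P Q : Measure X} {a : ℝ≥0∞} (h : HasAffinity P Q a) {φ : X → Y}
    (hφ : MeasurableEmbedding φ) {ψ : Y → X} (hψ : Measurable ψ) (hinv : ∀ x, ψ (φ x) = x) :
    HasAffinity (P.map φ) (Q.map φ) a := by
  obtain ⟨τ, hτ, f, g, hf, hg, hP, hQ, ha⟩ := h
  have key : ∀ (f : X → ℝ≥0) (P : Measure X), Measurable f → τ.withDensity (fun x => f x) ≤ P →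
      (τ.map φ).withDensity (fun y => f (ψ y)) ≤ P.map φ := by
    intro f P hf hP
    refine Measure.le_iff.2 fun s hs => ?_
    rw [withDensity_apply _ hs, Measure.map_apply hφ.measurable hs,
      setLIntegral_map hs (by fun_prop) hφ.measurable]
    refine le_trans (le_of_eq ?_) (hP (φ ⁻¹' s))
    rw [withDensity_apply _ (hφ.measurable hs)]
    simp [hinv]
  refine ⟨τ.map φ, inferInstance, f ∘ ψ, g ∘ ψ, hf.comp hψ, hg.comp hψ, key f P hf hP,
    key g Q hg hQ, ?_⟩
  rw [lintegral_map (by fun_prop) hφ.measurable]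
  simpa [hinv] using ha

theorem HasAffinity.prod {P Q : Measure X} {P' Q' : Measure Y} [SFinite P'] [SFinite Q']
    {a b : ℝ≥0∞} (h : HasAffinity P Q a) (h' : HasAffinity P' Q' b) :
    HasAffinity (P.prod P') (Q.prod Q') (a * b) := by
  obtain ⟨τ, hτ, f, g, hf, hg, hP, hQ, ha⟩ := h
  obtain ⟨τ', hτ', f', g', hf', hg', hP', hQ', hb⟩ := h'
  refine ⟨τ.prod τ', inferInstance, fun z => f z.1 * f' z.2, fun z => g z.1 * g' z.2,
    by fun_prop, by fun_prop, ?_, ?_, ?_⟩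
  · simp only [ENNReal.coe_mul]
    rw [← prod_withDensity (f := fun x => (f x : ℝ≥0∞)) (g := fun y => (f' y : ℝ≥0∞))
      (by fun_prop) (by fun_prop)]
    exact Measure.prod_mono hP hP'
  · simp only [ENNReal.coe_mul]
    rw [← prod_withDensity (f := fun x => (g x : ℝ≥0∞)) (g := fun y => (g' y : ℝ≥0∞))
      (by fun_prop) (by fun_prop)]
    exact Measure.prod_mono hQ hQ'
  · have : ∀ z : X × Y, ((NNReal.sqrt (f z.1 * f' z.2 * (g z.1 * g' z.2)) : ℝ≥0) : ℝ≥0∞) =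
        (NNReal.sqrt (f z.1 * g z.1) : ℝ≥0) * (NNReal.sqrt (f' z.2 * g' z.2) : ℝ≥0) := by
      intro z
      rw [← ENNReal.coe_mul, ← NNReal.sqrt_mul]
      congr 2
      ring
    simp only [this]
    rw [lintegral_prod_mul (f := fun x => ((NNReal.sqrt (f x * g x) : ℝ≥0) : ℝ≥0∞))
      (g := fun y => ((NNReal.sqrt (f' y * g' y) : ℝ≥0) : ℝ≥0∞)) (by fun_prop) (by fun_prop)]
    exact mul_le_mul' ha hb

theorem HasAffinity.pi {P Q : Measure X} [IsProbabilityMeasure P] [IsProbabilityMeasure Q]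
    {a : ℝ≥0∞} (h : HasAffinity P Q a) (n : ℕ) :
    HasAffinity (Measure.pi fun _ : Fin n => P) (Measure.pi fun _ : Fin n => Q) (a ^ n) := by
  induction n with
  | zero =>
    rw [Measure.pi_of_empty (x := isEmptyElim), Measure.pi_of_empty (x := isEmptyElim), pow_zero]
    exact HasAffinity.refl _
  | succ n ih =>
    have key : ∀ (P : Measure X) [IsProbabilityMeasure P], (Measure.pi fun _ : Fin (n + 1) => P) =
        (P.prod (Measure.pi fun _ : Fin n => P)).map
          (MeasurableEquiv.piFinSuccAbove (fun _ => X) 0).symm := fun P _ =>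
      ((measurePreserving_piFinSuccAbove (fun _ : Fin (n + 1) => P) 0).symm _).map_eq.symm
    rw [key P, key Q, pow_succ']
    exact (h.prod ih).map (MeasurableEquiv.measurableEmbedding _)
      (MeasurableEquiv.piFinSuccAbove (fun _ => X) 0).measurable
      (MeasurableEquiv.apply_symm_apply _)

/-- The index is part of the observation, so the components live on disjoint slices and the affinity
of the mixtures is the `w`-average of the affinities. Nothing is lost with the number of components.
-/
theorem HasAffinity.sum {J : Type*} [Fintype J] [MeasurableSpace J] [MeasurableSingletonClass J]
    (w : J → ℝ≥0∞) (hw : ∑ j, w j = 1) {P Q : J → Measure X} {a : ℝ≥0∞}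
    (h : ∀ j, HasAffinity (P j) (Q j) a) :
    HasAffinity (∑ j, w j • (P j).map (Prod.mk j)) (∑ j, w j • (Q j).map (Prod.mk j)) a := by
  choose τ hτ f g hf hg hP hQ ha using h
  have hw' : ∀ j, w j ≠ ∞ := fun j hj => by
    have := Finset.single_le_sum (fun i _ => zero_le (a := w i)) (Finset.mem_univ j)
    rw [hw, hj] at this
    simp at this
  have hmeas : ∀ f : J → X → ℝ≥0, (∀ j, Measurable (f j)) →
      Measurable fun z : J × X => f z.1 z.2 := fun f hf =>
    measurable_from_prod_countable_right hf
  have key : ∀ (f : J → X → ℝ≥0) (P : J → Measure X), (∀ j, Measurable (f j)) →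
      (∀ j, (τ j).withDensity (fun x => f j x) ≤ P j) →
      (∑ j, w j • (τ j).map (Prod.mk j)).withDensity (fun z : J × X => (f z.1 z.2 : ℝ≥0∞)) ≤
        ∑ j, w j • (P j).map (Prod.mk j) := by
    intro f P hf hP
    refine Measure.le_iff.2 fun s hs => ?_
    rw [withDensity_apply _ hs, ← lintegral_indicator hs, lintegral_finsetSum_measure,
      Measure.finsetSum_apply]
    refine Finset.sum_le_sum fun j _ => ?_
    rw [lintegral_smul_measure, Measure.smul_apply, lintegral_indicator hs,
      setLIntegral_map hs (hmeas f hf).coe_nnreal_ennreal measurable_prodMk_left,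
      Measure.map_apply measurable_prodMk_left hs]
    gcongr
    exact le_trans (le_of_eq (withDensity_apply _ (measurable_prodMk_left hs)).symm) (hP j _)
  have hs : ∀ j, SFinite (w j • (τ j).map (Prod.mk j)) := fun j => by
    have := hτ j
    infer_instance
  refine ⟨∑ j, w j • (τ j).map (Prod.mk j), ?_, fun z => f z.1 z.2, fun z => g z.1 z.2,
    hmeas f hf, hmeas g hg, key f P hf hP, key g Q hg hQ, ?_⟩
  · rw [← Measure.sum_fintype]
    infer_instance
  · rw [lintegral_finsetSum_measure]
    have h1 := hmeas f hf
    have h2 := hmeas g hg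
    calc a = ∑ j, w j * a := by rw [← Finset.sum_mul, hw, one_mul]
      _ ≤ _ := Finset.sum_le_sum fun j _ => by
        rw [lintegral_smul_measure, lintegral_map (by fun_prop) measurable_prodMk_left]
        exact mul_le_mul_right (ha j) _

/-- The common part has density `min f g`, of mass `A`; let `B` be the mass of `max f g`. As `f g =
min f g * max f g`, Cauchy–Schwarz gives `a ^ 2 ≤ A B`. With `A + B ≤ 2` this is at most `A (2 - A)
= 1 - (1 - A) ^ 2`. -/
theorem HasAffinity.overlaps {P Q : Measure X} [IsProbabilityMeasure P] [IsProbabilityMeasure Q]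
    {a : ℝ} (ha : 0 ≤ a) (h : HasAffinity P Q (ENNReal.ofReal a)) :
    Overlaps P Q (√(1 - a ^ 2)) := by
  obtain ⟨τ, hτ, f, g, hf, hg, hP, hQ, hle⟩ := h
  have le_of : ∀ (u v : X → ℝ≥0) (S : Measure X), (∀ x, u x ≤ v x) →
      τ.withDensity (fun x => v x) ≤ S → τ.withDensity (fun x => u x) ≤ S := fun u v S huv h =>
    (withDensity_mono (ae_of_all _ fun x => by exact_mod_cast huv x)).trans h
  have mass : ∀ (u : X → ℝ≥0) (S : Measure X) [IsProbabilityMeasure S],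
      τ.withDensity (fun x => u x) ≤ S → ∫⁻ x, u x ∂τ ≤ 1 := fun u S _ h => by
    have := h Set.univ
    rwa [withDensity_apply _ .univ, setLIntegral_univ, measure_univ] at this
  set m := fun x => min (f x) (g x) with hm
  set M := fun x => max (f x) (g x) with hM
  have hmm : Measurable m := hf.min hg
  have hMm : Measurable M := hf.max hg
  have hmP := le_of m f P (fun x => min_le_left _ _) hP
  have hmQ := le_of m g Q (fun x => min_le_right _ _) hQ
  have hm1 := mass m P hmP
  have hsum : ∫⁻ x, m x ∂τ + ∫⁻ x, M x ∂τ ≤ 2 := by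
    rw [← lintegral_add_left (by fun_prop)]
    have : ∀ x, (m x : ℝ≥0∞) + M x = f x + g x := fun x => by
      rw [← ENNReal.coe_add, ← ENNReal.coe_add, min_add_max]
    simp only [this]
    rw [lintegral_add_left (by fun_prop)]
    calc _ ≤ (1 : ℝ≥0∞) + 1 := add_le_add (mass f P hP) (mass g Q hQ)
      _ = 2 := by norm_num
  have hcs : ∫⁻ x, NNReal.sqrt (f x * g x) ∂τ ≤
      (∫⁻ x, m x ∂τ) ^ (1 / 2 : ℝ) * (∫⁻ x, M x ∂τ) ^ (1 / 2 : ℝ) := by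
    have hsq : ∀ u : ℝ≥0, ((NNReal.sqrt u : ℝ≥0) : ℝ≥0∞) ^ (2 : ℝ) = u := fun u => by
      rw [ENNReal.rpow_two, ← ENNReal.coe_pow, NNReal.sq_sqrt]
    have := ENNReal.lintegral_mul_le_Lp_mul_Lq τ Real.HolderConjugate.two_two
      (f := fun x => (NNReal.sqrt (m x) : ℝ≥0∞)) (g := fun x => (NNReal.sqrt (M x) : ℝ≥0∞))
      (by fun_prop) (by fun_prop)
    simp only [hsq, Pi.mul_apply, ← ENNReal.coe_mul, ← NNReal.sqrt_mul] at this
    simpa only [hm, hM, min_mul_max] using this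
  set A := (∫⁻ x, m x ∂τ).toReal with hA
  set B := (∫⁻ x, M x ∂τ).toReal with hB
  have hmtop : ∫⁻ x, m x ∂τ ≠ ∞ := ne_top_of_le_ne_top ENNReal.one_ne_top hm1
  have hMtop : ∫⁻ x, M x ∂τ ≠ ∞ :=
    ne_top_of_le_ne_top ENNReal.ofNat_ne_top ((le_add_self).trans hsum)
  have hA0 : 0 ≤ A := ENNReal.toReal_nonneg
  have hB0 : 0 ≤ B := ENNReal.toReal_nonneg
  have hAB : A + B ≤ 2 := by
    rw [hA, hB, ← ENNReal.toReal_add hmtop hMtop]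
    exact ENNReal.toReal_le_of_le_ofReal (by norm_num) (by simpa using hsum)
  have haAB : a ≤ √A * √B := by
    have h3 := hle.trans hcs
    rw [← ENNReal.ofReal_toReal hmtop, ← ENNReal.ofReal_toReal hMtop,
      ENNReal.ofReal_rpow_of_nonneg hA0 (by norm_num),
      ENNReal.ofReal_rpow_of_nonneg hB0 (by norm_num), ← Real.sqrt_eq_rpow, ← Real.sqrt_eq_rpow,
      ← ENNReal.ofReal_mul (Real.sqrt_nonneg _)] at h3
    exact (ENNReal.ofReal_le_ofReal_iff (by positivity)).1 h3
  have hsq : a ^ 2 ≤ A * B := by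
    calc a ^ 2 ≤ (√A * √B) ^ 2 := by gcongr
      _ = A * B := by rw [mul_pow, Real.sq_sqrt hA0, Real.sq_sqrt hB0]
  refine ⟨τ.withDensity fun x => m x, hmP, hmQ, ?_⟩
  rw [measureReal_def, withDensity_apply _ .univ, setLIntegral_univ]
  have : 1 - A ≤ √(1 - a ^ 2) := by
    refine Real.le_sqrt_of_sq_le ?_
    nlinarith [mul_le_mul_of_nonneg_left hAB hA0]
  linarith

theorem HasAffinity.overlaps_pi {P Q : Measure X} [IsProbabilityMeasure P]
    [IsProbabilityMeasure Q] {h : ℝ} (hPQ : HasAffinity P Q (ENNReal.ofReal (1 - h))) (n : ℕ) :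
    Overlaps (Measure.pi fun _ : Fin n => P) (Measure.pi fun _ : Fin n => Q) (√(2 * n * h)) := by
  by_cases hn : 1 ≤ 2 * n * h
  · exact overlaps_of_one_le _ _ (Real.one_le_sqrt.2 hn)
  by_cases hh : h ≤ 1
  · have h1 : 0 ≤ 1 - h := by linarith
    have := (hPQ.pi n)
    rw [← ENNReal.ofReal_pow h1] at this
    refine (this.overlaps (by positivity)).mono (Real.sqrt_le_sqrt ?_)
    -- Bernoulli's inequality: `(1 - h) ^ (2 n) ≥ 1 - 2 n h`.
    have hb := one_add_mul_le_pow (a := -h) (by linarith) (n * 2)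
    rw [← pow_mul]
    push_cast at hb
    have e : 1 + -h = 1 - h := by ring
    rw [e] at hb
    linarith
  -- For `h > 1` the affinity bound is void, but then `2 n h < 1` forces `n = 0`, where both
  -- products are the same point mass.
  · rcases Nat.eq_zero_or_pos n with rfl | hn0
    · have e : ∀ S : Measure X, (Measure.pi fun _ : Fin 0 => S) = Measure.dirac isEmptyElim :=
        fun S => Measure.pi_of_empty _ _
      rw [e P, e Q]
      exact ⟨_, le_rfl, le_rfl, by simp⟩
    · have : (1 : ℝ) ≤ n := by exact_mod_cast hn0
      nlinarith

end Affinity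

/-! ### Coordinatewise randomized maps -/

section Kernels

variable {X Y Ω : Type*} [MeasurableSpace X] [MeasurableSpace Y] [MeasurableSpace Ω]

theorem exists_kernel_pi_map {F : X → Y} (hF : Measurable F) (n : ℕ) :
    ∃ κ : Kernel (Fin n → X) (Fin n → Y), IsMarkovKernel κ ∧
      ∀ (P : Measure X) [IsProbabilityMeasure P],
        κ ∘ₘ (Measure.pi fun _ => P) = Measure.pi fun _ => P.map F := by
  have hm : Measurable fun (x : Fin n → X) i => F (x i) := by fun_prop
  refine ⟨Kernel.deterministic _ hm, inferInstance, fun P _ => ?_⟩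
  have := Measure.isProbabilityMeasure_map (μ := P) hF.aemeasurable
  rw [Measure.deterministic_comp_eq_map, Measure.pi_map_pi fun _ => hF.aemeasurable]

/-- Each coordinate receives its own independent noise with law `U`. The kernel is chosen before
`P`, so it may serve all parameters at once. -/
theorem exists_kernel_pi_prod_map (U : Measure Ω) [IsProbabilityMeasure U] {F : X × Ω → Y}
    (hF : Measurable F) (n : ℕ) :
    ∃ κ : Kernel (Fin n → X) (Fin n → Y), IsMarkovKernel κ ∧
      ∀ (P : Measure X) [IsProbabilityMeasure P],
        κ ∘ₘ (Measure.pi fun _ => P) = Measure.pi fun _ => (P.prod U).map F := by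
  have hm : Measurable fun (z : (Fin n → X) × (Fin n → Ω)) i => F (z.1 i, z.2 i) := by fun_prop
  refine ⟨(Kernel.id ×ₖ Kernel.const _ (Measure.pi fun _ => U)).map
    fun (z : (Fin n → X) × (Fin n → Ω)) i => F (z.1 i, z.2 i),
    Kernel.IsMarkovKernel.map _ hm, fun P _ => ?_⟩
  have := Measure.isProbabilityMeasure_map (μ := P.prod U) hF.aemeasurable
  rw [← Measure.map_comp _ _ hm, ← Measure.compProd_eq_comp_prod, Measure.compProd_const,
    ← Measure.pi_map_pi fun _ => hF.aemeasurable,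
    ← (measurePreserving_arrowProdEquivProdArrow X Ω (Fin n) (fun _ => P) (fun _ => U)).map_eq,
    Measure.map_map hm (MeasurableEquiv.measurable _)]
  rfl

variable {J : Type*} [Fintype J]

theorem map_sum_smul (w : J → ℝ≥0∞) (P : J → Measure X) {F : X → Y} (hF : Measurable F) :
    (∑ j, w j • P j).map F = ∑ j, w j • (P j).map F := by
  ext s hs
  simp [Measure.map_apply hF hs, Measure.finsetSum_apply]

theorem sum_smul_prod (w : J → ℝ≥0∞) (P : J → Measure X) (U : Measure Ω) [SFinite U] :
    (∑ j, w j • P j).prod U = ∑ j, w j • (P j).prod U := by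
  ext s hs
  rw [Measure.prod_apply hs, lintegral_finsetSum_measure, Measure.finsetSum_apply]
  refine Finset.sum_congr rfl fun j _ => ?_
  rw [lintegral_smul_measure, Measure.smul_apply, Measure.prod_apply hs]

theorem isProbabilityMeasure_sum_smul {w : J → ℝ≥0∞} (hw : ∑ j, w j = 1) (P : J → Measure X)
    [∀ j, IsProbabilityMeasure (P j)] : IsProbabilityMeasure (∑ j, w j • P j) :=
  ⟨by simpa [Measure.finsetSum_apply] using hw⟩

theorem sum_pmf {J : Type*} [Fintype J] (p : PMF J) : ∑ j, p j = 1 := by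
  rw [← tsum_fintype (L := .unconditional _)]
  exact p.tsum_coe

/-- A measurable map acting within the components of a mixture. -/
theorem map_mixture {Z Z' : J → Type*} [∀ j, MeasurableSpace (Z j)] [∀ j, MeasurableSpace (Z' j)]
    {w : J → ℝ≥0∞} {P : ∀ j, Measure (Z j)} {e : ∀ j, Z j → X} {e' : ∀ j, Z' j → Y}
    (he : ∀ j, Measurable (e j)) (he' : ∀ j, Measurable (e' j)) {F : X → Y} (hF : Measurable F)
    {G : ∀ j, Z j → Z' j} (hG : ∀ j, Measurable (G j))
    (hFG : ∀ j x, F (e j x) = e' j (G j x)) :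
    (∑ j, w j • (P j).map (e j)).map F = ∑ j, w j • ((P j).map (G j)).map (e' j) := by
  rw [map_sum_smul _ _ hF]
  refine Finset.sum_congr rfl fun j _ => ?_
  rw [Measure.map_map hF (he j), Measure.map_map (he' j) (hG j)]
  congr 2
  exact funext fun x => hFG j x

/-- A randomized map acting within the components of a mixture. -/
theorem prod_map_mixture {Z Z' : J → Type*} [∀ j, MeasurableSpace (Z j)]
    [∀ j, MeasurableSpace (Z' j)] (U : Measure Ω) [IsProbabilityMeasure U]
    {w : J → ℝ≥0∞} {P : ∀ j, Measure (Z j)} [∀ j, IsProbabilityMeasure (P j)]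
    {e : ∀ j, Z j → X} {e' : ∀ j, Z' j → Y}
    (he : ∀ j, Measurable (e j)) (he' : ∀ j, Measurable (e' j)) {F : X × Ω → Y}
    (hF : Measurable F) {G : ∀ j, Z j × Ω → Z' j} (hG : ∀ j, Measurable (G j))
    (hFG : ∀ j x u, F (e j x, u) = e' j (G j (x, u))) :
    ((∑ j, w j • (P j).map (e j)).prod U).map F =
      ∑ j, w j • (((P j).prod U).map (G j)).map (e' j) := by
  rw [sum_smul_prod, map_sum_smul _ _ hF]
  refine Finset.sum_congr rfl fun j _ => ?_
  have : ((P j).map (e j)).prod U = ((P j).prod U).map (Prod.map (e j) id) := by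
    rw [← Measure.map_prod_map _ _ (he j) measurable_id, Measure.map_id]
  rw [this, Measure.map_map hF ((he j).prodMap measurable_id), Measure.map_map (he' j) (hG j)]
  congr 2
  exact funext fun x => hFG j x.1 x.2

end Kernels

/-! ### Measuring an involution -/

section Involution

variable {ι : Type} [Fintype ι] [DecidableEq ι] {B : Matrix ι ι ℂ}

/-- Since `T ^ 2 = 1`, the vector `(u + x T u) / 2` is an eigenvector for `x` or zero; since `T` is
self-adjoint, the remainder `(u - x T u) / 2` is orthogonal to the eigenspace. The number `x` need
not be an eigenvalue: both sides vanish otherwise. -/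
theorem eigenProj_of_involution (hB : B.IsHermitian) (hBB : B * B = 1) {x : ℝ} (hx : x ^ 2 = 1) :
    eigenProj B x = (1 / 2 : ℂ) • (1 + (x : ℂ) • B) := by
  have hx' : (x : ℂ) * x = 1 := by rw [← sq]; exact_mod_cast hx
  rw [eigenProj, StarAlgEquiv.symm_apply_eq]
  set T := Matrix.toEuclideanCLM (n := ι) (𝕜 := ℂ) B with hT
  have hTT : ∀ v, T (T v) = v := fun v => by
    have : T * T = 1 := by rw [hT, ← map_mul, hBB, map_one]
    simpa using congrArg (fun S => S v) this
  have hsa : ∀ v w, inner ℂ (T v) w = inner ℂ v (T w) := by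
    have hs : IsSelfAdjoint T := by
      have : IsSelfAdjoint B := hB
      exact this.map _
    exact fun v w => (ContinuousLinearMap.isSelfAdjoint_iff_isSymmetric.1 hs) v w
  have hval : ∀ u, Matrix.toEuclideanCLM (n := ι) (𝕜 := ℂ)
      ((1 / 2 : ℂ) • (1 + (x : ℂ) • B)) u = (1 / 2 : ℂ) • (u + (x : ℂ) • T u) := fun u => by
    rw [map_smul, map_add, map_smul, map_one]
    rfl
  have hmem : ∀ v, v ∈ Module.End.eigenspace (Matrix.toEuclideanLin B) (x : ℂ) ↔
      T v = (x : ℂ) • v := fun v => by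
    rw [Module.End.mem_eigenspace_iff, ← Matrix.coe_toEuclideanCLM_eq_toEuclideanLin]
    rfl
  ext1 u
  rw [hval]
  refine Submodule.eq_starProjection_of_mem_orthogonal ?_ ?_
  · rw [hmem, map_smul, map_add, map_smul, hTT, smul_comm (x : ℂ) (1 / 2 : ℂ), smul_add (x : ℂ),
      smul_smul (x : ℂ), hx', one_smul, add_comm]
  · rw [Submodule.mem_orthogonal]
    intro w hw
    rw [hmem] at hw
    have h1 : inner ℂ w (T u) = (x : ℂ) * inner ℂ w u := by
      rw [← hsa, hw, inner_smul_left]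
      simp
    rw [inner_sub_right, inner_smul_right, inner_add_right, inner_smul_right, h1, ← mul_assoc, hx']
    ring

theorem outcomeProb_of_involution (hB : B.IsHermitian) (hBB : B * B = 1) {ρ : Matrix ι ι ℂ}
    (hρ : ρ.trace = 1) {x : ℝ} (hx : x ^ 2 = 1) :
    outcomeProb B ρ x = (1 + x * (B * ρ).trace.re) / 2 := by
  rw [outcomeProb, eigenProj_of_involution hB hBB hx]
  simp only [smul_mul_assoc, add_mul, one_mul, Matrix.trace_smul, Matrix.trace_add, hρ, smul_eq_mul]
  have : (1 / 2 : ℂ) * (1 + x * (B * ρ).trace) = ((1 / 2 : ℝ) : ℂ) * (1 + x * (B * ρ).trace) := by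
    norm_num
  rw [this, Complex.re_ofReal_mul, Complex.add_re, Complex.re_ofReal_mul, Complex.one_re]
  ring

/-- If `x ^ 2 ≠ 1`, then `(x - B) (x + B) = x ^ 2 - 1` makes `x - B` invertible. -/
theorem sq_eq_one_of_mem_outcomes (hBB : B * B = 1) {x : ℝ} (hx : x ∈ outcomes B) :
    x ^ 2 = 1 := by
  by_contra h
  rw [outcomes, Set.Finite.mem_toFinset, spectrum.mem_iff] at hx
  refine hx ?_
  have h' : x ^ 2 - 1 ≠ 0 := sub_ne_zero.2 h
  have e : (algebraMap ℝ (Matrix ι ι ℂ) x - B) * (algebraMap ℝ _ x + B) =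
      algebraMap ℝ _ (x ^ 2 - 1) := by
    rw [sub_mul, mul_add, mul_add, hBB, Algebra.commutes x B, map_sub, map_pow, map_one, sq]
    abel
  have e' : (algebraMap ℝ (Matrix ι ι ℂ) x - B) *
      ((algebraMap ℝ _ x + B) * algebraMap ℝ _ (x ^ 2 - 1)⁻¹) = 1 := by
    rw [← mul_assoc, e, ← map_mul, mul_inv_cancel₀ h', map_one]
  exact IsUnit.of_mul_eq_one _ e'

/-- This covers involutions with a single eigenvalue, such as the identity. From `(x - B) (1 + x B)
= 0` and invertibility of `x - B` it follows that `1 + x B`, twice the projection, is zero. -/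
theorem outcomeProb_eq_zero_of_notMem (hB : B.IsHermitian) (hBB : B * B = 1) {ρ : Matrix ι ι ℂ}
    {x : ℝ} (hx : x ^ 2 = 1) (h : x ∉ outcomes B) : outcomeProb B ρ x = 0 := by
  rw [outcomes, Set.Finite.mem_toFinset, spectrum.mem_iff, not_not] at h
  have e : (algebraMap ℝ (Matrix ι ι ℂ) x - B) * (1 + algebraMap ℝ (Matrix ι ι ℂ) x * B) = 0 := by
    have h1 : algebraMap ℝ (Matrix ι ι ℂ) x * algebraMap ℝ (Matrix ι ι ℂ) x = 1 := by
      rw [← map_mul, ← sq, hx, map_one]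
    rw [sub_mul, mul_add, mul_add, mul_one, mul_one, ← mul_assoc, h1, one_mul, ← mul_assoc,
      ← Algebra.commutes x B, mul_assoc, hBB, mul_one]
    abel
  have hz := (h.mul_right_eq_zero).1 e
  have hz' : (1 : Matrix ι ι ℂ) + (x : ℂ) • B = 0 := by
    rw [← hz, Algebra.algebraMap_eq_smul_one, smul_mul_assoc, one_mul]
    ext i j
    simp
  rw [outcomeProb, eigenProj_of_involution hB hBB hx, hz']
  simp

/-- Sums over the outcomes, weighted with their probabilities, may be extended to `{1, -1}`. -/
theorem sum_outcomes {M : Type*} [AddCommMonoid M] (hB : B.IsHermitian) (hBB : B * B = 1)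
    {ρ : Matrix ι ι ℂ} {F : ℝ → ℝ → M} (hF : ∀ x, F x 0 = 0) :
    ∑ x ∈ outcomes B, F x (outcomeProb B ρ x) =
      F 1 (outcomeProb B ρ 1) + F (-1) (outcomeProb B ρ (-1)) := by
  have hsub : outcomes B ⊆ {1, -1} := fun x hx => by
    simpa using sq_eq_one_of_mem_outcomes hBB hx
  rw [Finset.sum_subset hsub, Finset.sum_pair (by norm_num)]
  intro x hx hx'
  have : x ^ 2 = 1 := by
    rcases Finset.mem_insert.1 hx with rfl | h
    · norm_num
    · rw [Finset.mem_singleton.1 h]; norm_num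
  rw [outcomeProb_eq_zero_of_notMem hB hBB this hx', hF]

/-- For the projection `M` one has `tr (M ρ) = tr (M ρ Mᴴ)`, the trace of a positive semidefinite
matrix. -/
theorem outcomeProb_nonneg (hB : B.IsHermitian) (hBB : B * B = 1) {ρ : Matrix ι ι ℂ}
    (hρ : ρ.PosSemidef) {x : ℝ} (hx : x ^ 2 = 1) : 0 ≤ outcomeProb B ρ x := by
  have hx' : (x : ℂ) * x = 1 := by rw [← sq]; exact_mod_cast hx
  rw [outcomeProb, eigenProj_of_involution hB hBB hx]
  set M := (1 / 2 : ℂ) • (1 + (x : ℂ) • B) with hM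
  have hMM : M * M = M := by
    rw [hM, smul_mul_smul_comm, mul_add, add_mul, add_mul, smul_mul_smul_comm, hBB, hx', one_mul,
      one_mul, mul_one, one_smul]
    ext i j
    simp
    ring
  have hMh : M.conjTranspose = M := by
    rw [hM, Matrix.conjTranspose_smul, Matrix.conjTranspose_add, Matrix.conjTranspose_smul,
      hB.eq, Matrix.conjTranspose_one]
    simp
  have h := (hρ.mul_mul_conjTranspose_same M).trace_nonneg
  rw [hMh, Matrix.trace_mul_comm, ← mul_assoc, hMM] at h
  exact (Complex.le_def.1 h).1

theorem outcomeLaw_of_involution (hB : B.IsHermitian) (hBB : B * B = 1) {ρ : Matrix ι ι ℂ} :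
    outcomeLaw B ρ = ENNReal.ofReal (outcomeProb B ρ 1) • Measure.dirac 1 +
      ENNReal.ofReal (outcomeProb B ρ (-1)) • Measure.dirac (-1) :=
  sum_outcomes hB hBB (F := fun x p => ENNReal.ofReal p • Measure.dirac x) (by simp)

theorem mem_properOutcomes (hB : B.IsHermitian) (hBB : B * B = 1) {ρ : Matrix ι ι ℂ} {x : ℝ} :
    x ∈ properOutcomes B ρ ↔ x ^ 2 = 1 ∧ 0 < outcomeProb B ρ x ∧ outcomeProb B ρ x < 1 := by
  rw [properOutcomes, Finset.mem_filter]
  refine and_congr_left fun h => ⟨sq_eq_one_of_mem_outcomes hBB, fun hx => ?_⟩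
  by_contra hx'
  exact h.1.ne' (outcomeProb_eq_zero_of_notMem hB hBB hx hx')

end Involution

/-! ### The Pauli basis -/

section Pauli

theorem sigma_mul_self (k : Fin 4) : sigma k * sigma k = 1 := by
  fin_cases k <;> ext i j <;> fin_cases i <;> fin_cases j <;>
    simp [sigma, Matrix.mul_apply, Fin.sum_univ_two]

theorem star_sigma_apply (k : Fin 4) (i j : Fin 2) : star (sigma k j i) = sigma k i j := by
  fin_cases k <;> fin_cases i <;> fin_cases j <;> simp [sigma]

theorem sigma_zero : sigma 0 = 1 := by
  ext i j
  fin_cases i <;> fin_cases j <;> simp [sigma]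

theorem trace_sigma {k : Fin 4} (hk : k ≠ 0) : ∑ i, sigma k i i = 0 := by
  fin_cases k
  · exact absurd rfl hk
  all_goals simp [sigma]

theorem isHermitian_pauli (b : ℕ) (l : PauliIndex b) : (pauli b l).IsHermitian := by
  ext x y
  simp only [pauli, Matrix.conjTranspose_apply, Matrix.of_apply, star_prod, star_sigma_apply]

theorem prod_sum_qubit {b : ℕ} (f : Fin b → Fin 2 → ℂ) :
    ∑ y : QubitIndex b, ∏ i, f i (y i) = ∏ i, ∑ j, f i j := by
  rw [Finset.prod_univ_sum, Fintype.piFinset_univ]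

theorem pauli_mul_self (b : ℕ) (l : PauliIndex b) : pauli b l * pauli b l = 1 := by
  ext x z
  simp only [pauli, Matrix.mul_apply, Matrix.of_apply, ← Finset.prod_mul_distrib]
  rw [prod_sum_qubit fun i j => sigma (l i) (x i) j * sigma (l i) j (z i)]
  simp only [← Matrix.mul_apply, sigma_mul_self, Matrix.one_apply]
  simp [Fintype.prod_boole, funext_iff]

theorem pauli_zero (b : ℕ) : pauli b 0 = 1 := by
  ext x z
  simp only [pauli, Matrix.of_apply, Pi.zero_apply, sigma_zero, Matrix.one_apply]
  simp [Fintype.prod_boole, funext_iff]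

theorem trace_pauli {b : ℕ} {l : PauliIndex b} (hl : l ≠ 0) : (pauli b l).trace = 0 := by
  obtain ⟨i, hi⟩ := Function.ne_iff.1 hl
  simp only [Matrix.trace, Matrix.diag_apply, pauli, Matrix.of_apply]
  rw [prod_sum_qubit fun i j => sigma (l i) j j]
  exact Finset.prod_eq_zero (Finset.mem_univ i) (trace_sigma hi)

/-- The maximally mixed state. -/
def maximallyMixed (b : ℕ) : Matrix (QubitIndex b) (QubitIndex b) ℂ :=
  ((2 : ℂ) ^ b)⁻¹ • 1

theorem maximallyMixed_mem {b s : ℕ} (hs : 1 ≤ s) : maximallyMixed b ∈ sparsePauli b s := by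
  refine ⟨⟨?_, ?_⟩, fun l => if l = 0 then ((2 : ℂ) ^ b)⁻¹ else 0, ?_, ?_⟩
  · exact Matrix.PosSemidef.one.smul (by positivity)
  · simp [maximallyMixed, Matrix.trace_smul, Matrix.trace_one]
  · simp [maximallyMixed, pauli_zero]
  · refine le_trans (Finset.card_le_card (t := {0}) fun l hl => ?_) (by simpa using hs)
    by_contra h
    simp_all

theorem two_le_card_properOutcomes {b : ℕ} {l : PauliIndex b} (hl : l ≠ 0) :
    2 ≤ (properOutcomes (pauli b l) (maximallyMixed b)).card := by
  have hprob : ∀ x : ℝ, x ^ 2 = 1 → outcomeProb (pauli b l) (maximallyMixed b) x = 1 / 2 := by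
    intro x hx
    rw [outcomeProb_of_involution (isHermitian_pauli b l) (pauli_mul_self b l)
      (maximallyMixed_mem le_rfl).1.2 hx]
    simp [maximallyMixed, Matrix.trace_smul, trace_pauli hl]
  have hsub : ({1, -1} : Finset ℝ) ⊆ properOutcomes (pauli b l) (maximallyMixed b) := by
    intro x hx
    have hx : x ^ 2 = 1 := by simpa using hx
    rw [mem_properOutcomes (isHermitian_pauli b l) (pauli_mul_self b l), hprob x hx]
    norm_num [hx]
  refine le_trans ?_ (Finset.card_le_card hsub)
  rw [Finset.card_pair (by norm_num)]

/-- The fraction of the Pauli matrices whose measurement in the state `ρ` is not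
deterministic. -/
def properFraction (b : ℕ) (ρ : Matrix (QubitIndex b) (QubitIndex b) ℂ) : ℝ :=
  (1 / (4 : ℝ) ^ b) *
    ∑ l : PauliIndex b, if 2 ≤ (properOutcomes (pauli b l) ρ).card then (1 : ℝ) else 0

theorem properFraction_eq (b : ℕ) (ρ : Matrix (QubitIndex b) (QubitIndex b) ℂ) :
    properFraction b ρ = (1 / (4 : ℝ) ^ b) *
      (Finset.univ.filter fun l => 2 ≤ (properOutcomes (pauli b l) ρ).card).card := by
  rw [properFraction, Finset.sum_boole]

theorem zeta_eq_sSup (b s : ℕ) :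
    zeta (sparsePauli b s) (pauli b) (PMF.uniformOfFintype (PauliIndex b))
      (PMF.uniformOfFintype (PauliIndex b)) = sSup (properFraction b '' sparsePauli b s) := by
  rw [zeta]
  congr 2
  ext ρ
  rw [max_self, properFraction, Finset.mul_sum]
  refine Finset.sum_congr rfl fun l _ => ?_
  simp

/-- The fraction is a multiple of `4 ^ (-b)` between `0` and `1`, so its set of values is finite and
contains its supremum; no compactness argument is needed. -/
theorem isGreatest_zeta {b s : ℕ} (hs : 1 ≤ s) :
    IsGreatest (properFraction b '' sparsePauli b s)
      (zeta (sparsePauli b s) (pauli b) (PMF.uniformOfFintype (PauliIndex b))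
        (PMF.uniformOfFintype (PauliIndex b))) := by
  have hfin : (properFraction b '' sparsePauli b s).Finite := by
    refine Set.Finite.subset ((Finset.range (4 ^ b + 1)).finite_toSet.image
      fun k : ℕ => (1 / (4 : ℝ) ^ b) * k) ?_
    rintro _ ⟨ρ, -, rfl⟩
    refine ⟨_, ?_, (properFraction_eq b ρ).symm⟩
    have := Finset.card_filter_le Finset.univ
      fun l => 2 ≤ (properOutcomes (pauli b l) ρ).card
    simp only [Finset.card_univ, Fintype.card_pi, Fintype.card_fin, Finset.prod_const] at this
    simpa [Nat.lt_succ_iff] using this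
  rw [zeta_eq_sSup]
  have hne : (properFraction b '' sparsePauli b s).Nonempty := ⟨_, _, maximallyMixed_mem hs, rfl⟩
  exact ⟨hne.csSup_mem hfin, fun y hy => le_csSup hfin.bddAbove hy⟩

theorem properFraction_le_one (b : ℕ) (ρ : Matrix (QubitIndex b) (QubitIndex b) ℂ) :
    properFraction b ρ ≤ 1 := by
  rw [properFraction_eq, one_div, inv_mul_le_iff₀ (by positivity), mul_one]
  have := Finset.card_filter_le Finset.univ
    fun l => 2 ≤ (properOutcomes (pauli b l) ρ).card
  simp only [Finset.card_univ, Fintype.card_pi, Fintype.card_fin, Finset.prod_const] at this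
  exact_mod_cast this

theorem le_properFraction_maximallyMixed (b : ℕ) :
    1 - 1 / (4 : ℝ) ^ b ≤ properFraction b (maximallyMixed b) := by
  rw [properFraction_eq]
  have hsub : Finset.univ.erase (0 : PauliIndex b) ⊆
      Finset.univ.filter fun l => 2 ≤ (properOutcomes (pauli b l) (maximallyMixed b)).card := by
    intro l hl
    simpa using two_le_card_properOutcomes (Finset.ne_of_mem_erase hl)
  have h := Finset.card_le_card hsub
  rw [Finset.card_erase_of_mem (Finset.mem_univ _)] at h
  simp only [Finset.card_univ, Fintype.card_pi, Fintype.card_fin, Finset.prod_const] at h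
  have h' : (4 : ℝ) ^ b - 1 ≤ (Finset.univ.filter fun l =>
      2 ≤ (properOutcomes (pauli b l) (maximallyMixed b)).card).card := by
    have : 4 ^ b ≤ (Finset.univ.filter fun l =>
      2 ≤ (properOutcomes (pauli b l) (maximallyMixed b)).card).card + 1 := by omega
    rw [sub_le_iff_le_add]
    exact_mod_cast this
  calc 1 - 1 / (4 : ℝ) ^ b = (1 / (4 : ℝ) ^ b) * ((4 : ℝ) ^ b - 1) := by
        field_simp
    _ ≤ _ := by gcongr

end Pauli

/-! ### Local comparison of binomial weights and normal densities -/

section LocalLimit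

open Nat in
-- For the upper bound, the decrements of the logarithm of the Stirling sequence are at most `1 /
-- (12 k (k + 1))`, which telescopes. Thus the logarithm minus `1 / (12 k)` increases to its limit
-- `log √π`.
theorem log_factorial_stirling_bounds {n : ℕ} (hn : n ≠ 0) :
    0 ≤ Real.log (n ! : ℝ) - (n * Real.log n - n + Real.log n / 2 + Real.log (2 * Real.pi) / 2) ∧
    Real.log (n ! : ℝ) - (n * Real.log n - n + Real.log n / 2 + Real.log (2 * Real.pi) / 2) ≤
      1 / (12 * n) := by
  refine ⟨by linarith [Stirling.le_log_factorial_stirling hn], ?_⟩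
  have hmono : Monotone fun k : ℕ => Real.log (Stirling.stirlingSeq (k + 1)) -
      1 / (12 * ((k : ℝ) + 1)) := by
    refine monotone_nat_of_le_succ fun k => ?_
    have h := Stirling.log_stirlingSeq_sdiff_le (k + 1)
    have e : (1 : ℝ) / (12 * ((k + 1 : ℕ) : ℝ) * (((k + 1 : ℕ) : ℝ) + 1)) =
        1 / (12 * ((k : ℝ) + 1)) - 1 / (12 * (((k + 1 : ℕ) : ℝ) + 1)) := by
      push_cast
      field_simp
      ring
    rw [e] at h
    linarith
  have hlim : Filter.Tendsto (fun k : ℕ => Real.log (Stirling.stirlingSeq (k + 1)) -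
      1 / (12 * ((k : ℝ) + 1))) Filter.atTop (nhds (Real.log √Real.pi - 0)) := by
    refine Filter.Tendsto.sub ?_ ?_
    · exact ((Real.continuousAt_log (by positivity)).tendsto.comp
        Stirling.tendsto_stirlingSeq_sqrt_pi).comp (Filter.tendsto_add_atTop_nat 1)
    · have := (tendsto_one_div_add_atTop_nhds_zero_nat (𝕜 := ℝ)).const_mul (1 / 12)
      rw [mul_zero] at this
      refine this.congr fun k => ?_
      field_simp
  obtain ⟨k, rfl⟩ := Nat.exists_eq_succ_of_ne_zero hn
  have h := hmono.ge_of_tendsto hlim k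
  simp only [Nat.succ_eq_add_one] at h ⊢
  rw [Stirling.log_stirlingSeq_formula, Real.log_div (by positivity) (Real.exp_pos 1).ne',
    Real.log_exp, Real.log_sqrt Real.pi_pos.le,
    Real.log_mul (by norm_num) (by positivity)] at h
  rw [Real.log_mul (by norm_num) Real.pi_pos.ne']
  push_cast at h ⊢
  linarith

theorem abs_log_one_add_le {y : ℝ} (hy : |y| ≤ 1 / 2) : |Real.log (1 + y)| ≤ 2 * |y| := by
  have h := Real.abs_log_sub_add_sum_range_le (x := -y) (by rw [abs_neg]; linarith) 0
  simp only [Finset.range_zero, Finset.sum_empty, zero_add, pow_one, abs_neg, sub_neg_eq_add] at h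
  refine h.trans ?_
  rw [div_le_iff₀ (by linarith)]
  nlinarith [abs_nonneg y]

theorem abs_one_add_mul_log_one_add_sub_le {y : ℝ} (hy : |y| ≤ 1 / 2) :
    |(1 + y) * Real.log (1 + y) - y - y ^ 2 / 2| ≤ 4 * |y| ^ 3 := by
  have h := Real.abs_log_sub_add_sum_range_le (x := -y) (by rw [abs_neg]; linarith) 2
  simp only [Finset.sum_range_succ, Finset.range_zero, Finset.sum_empty, zero_add, abs_neg,
    sub_neg_eq_add] at h
  norm_num at h
  have h3 : |y| ^ 3 / (1 - |y|) ≤ 2 * |y| ^ 3 := by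
    rw [div_le_iff₀ (by linarith)]
    nlinarith [pow_nonneg (abs_nonneg y) 3]
  set r := -y + y ^ 2 / 2 + Real.log (1 + y) with hr
  have e : (1 + y) * Real.log (1 + y) - y - y ^ 2 / 2 = (1 + y) * r - y ^ 3 / 2 := by
    rw [hr]; ring
  have h1 : |1 + y| ≤ 3 / 2 := by
    have := abs_add_le 1 y
    rw [abs_one] at this
    linarith
  calc |(1 + y) * Real.log (1 + y) - y - y ^ 2 / 2| = |(1 + y) * r - y ^ 3 / 2| := by rw [e]
    _ ≤ |(1 + y) * r| + |y ^ 3 / 2| := abs_sub _ _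
    _ = |1 + y| * |r| + |y| ^ 3 / 2 := by rw [abs_mul, abs_div, abs_pow]; norm_num
    _ ≤ 3 / 2 * (2 * |y| ^ 3) + |y| ^ 3 / 2 := by
      gcongr
      exact h.trans h3
    _ ≤ 4 * |y| ^ 3 := by nlinarith [pow_nonneg (abs_nonneg y) 3]

/-- The weight of `k` under the binomial distribution with parameters `m` and `θ`. -/
def binomialWeight (m : ℕ) (θ : ℝ) (k : ℕ) : ℝ :=
  m.choose k * (θ ^ k * (1 - θ) ^ (m - k))

/-- The logarithm of the ratio of a smoothed binomial weight and the normal density, as the sum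
of a relative entropy term, a smoothing term, a variance term and a Stirling term. -/
theorem exists_log_ratio_eq {m k : ℕ} (hk : 0 < k) (hkm : k < m) {θ : ℝ} (h0 : 0 < θ) (h1 : θ < 1)
    {v : ℝ≥0} (hv : (v : ℝ) = 4 * θ * (1 - θ) / m) (x : ℝ) :
    ∃ r : ℝ, |r| ≤ 1 / k + 1 / (m - k) + 1 / m ∧
      Real.log (m / 2 * binomialWeight m θ k) - Real.log (gaussianPDFReal (2 * θ - 1) v x) =
        -(m * ((k / m) * Real.log ((k / m) / θ) + (1 - k / m) * Real.log ((1 - k / m) / (1 - θ)))) +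
        m * (x - (2 * θ - 1)) ^ 2 / (8 * θ * (1 - θ)) -
        (Real.log ((k / m) / θ) + Real.log ((1 - k / m) / (1 - θ))) / 2 + r := by
  have hm0 : (0 : ℝ) < m := by exact_mod_cast hk.trans hkm
  have hk0 : (0 : ℝ) < k := by exact_mod_cast hk
  have hl0 : (0 : ℝ) < m - k := by rw [sub_pos]; exact_mod_cast hkm
  have hθ : 0 < 1 - θ := by linarith
  have hcast : ((m - k : ℕ) : ℝ) = m - k := Nat.cast_sub hkm.le
  have sm := log_factorial_stirling_bounds (n := m) (by omega)
  have sk := log_factorial_stirling_bounds (n := k) (by omega)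
  have sl := log_factorial_stirling_bounds (n := m - k) (by omega)
  rw [hcast] at sl
  have hfac : ∀ n : ℕ, (0 : ℝ) < n.factorial := fun n => by exact_mod_cast n.factorial_pos
  have hchoose : Real.log (m.choose k : ℝ) = Real.log (m.factorial : ℝ) -
      Real.log (k.factorial : ℝ) - Real.log ((m - k).factorial : ℝ) := by
    rw [Nat.cast_choose ℝ hkm.le, Real.log_div (hfac m).ne' (by positivity),
      Real.log_mul (hfac _).ne' (hfac _).ne']
    ring
  have hch0 : (0 : ℝ) < m.choose k := by exact_mod_cast Nat.choose_pos hkm.le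
  set rm := Real.log (m.factorial : ℝ) -
    (m * Real.log m - m + Real.log m / 2 + Real.log (2 * Real.pi) / 2) with hrm
  set rk := Real.log (k.factorial : ℝ) -
    (k * Real.log k - k + Real.log k / 2 + Real.log (2 * Real.pi) / 2) with hrk
  set rl := Real.log ((m - k).factorial : ℝ) -
    ((m - k) * Real.log (m - k) - (m - k) + Real.log (m - k) / 2 +
      Real.log (2 * Real.pi) / 2) with hrl
  have weaken : ∀ y : ℝ, 0 < y → 1 / (12 * y) ≤ 1 / y := fun y hy =>
    one_div_le_one_div_of_le hy (by linarith)
  -- The remainder is what Stirling's formula leaves of `log (m choose k)`; all other terms match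
  -- exactly.
  refine ⟨rm - rk - rl, ?_, ?_⟩
  · have := weaken m hm0
    have := weaken k hk0
    have := weaken _ hl0
    have : 0 < 1 / (m : ℝ) := by positivity
    have : 0 < 1 / (k : ℝ) := by positivity
    have : 0 < 1 / ((m : ℝ) - k) := by positivity
    rw [abs_le]
    constructor <;> linarith [sm.1, sm.2, sk.1, sk.2, sl.1, sl.2]
  · have hv0 : (0 : ℝ) < v := by rw [hv]; positivity
    have e1 : 1 - (k : ℝ) / m = (m - k) / m := by field_simp
    have hlogpdf : Real.log (gaussianPDFReal (2 * θ - 1) v x) =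
        -(Real.log (2 * Real.pi) + (Real.log 4 + Real.log θ + Real.log (1 - θ) - Real.log m)) / 2 -
          m * (x - (2 * θ - 1)) ^ 2 / (8 * θ * (1 - θ)) := by
      rw [gaussianPDFReal, Real.log_mul (by positivity) (Real.exp_pos _).ne', Real.log_exp,
        Real.log_inv, Real.log_sqrt (by positivity), Real.log_mul (by positivity) hv0.ne', hv,
        Real.log_div (by positivity) hm0.ne', Real.log_mul (by positivity) hθ.ne',
        Real.log_mul (by norm_num) h0.ne']
      field_simp
      ring
    have hlog4 : Real.log 4 = 2 * Real.log 2 := by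
      rw [show (4 : ℝ) = 2 ^ 2 by norm_num, Real.log_pow]
      norm_num
    rw [hlogpdf, binomialWeight, Real.log_mul (by positivity) (by positivity),
      Real.log_div hm0.ne' two_ne_zero, Real.log_mul hch0.ne' (by positivity),
      Real.log_mul (by positivity) (by positivity), Real.log_pow, Real.log_pow, hcast, hchoose, e1,
      Real.log_div (by positivity) h0.ne', Real.log_div (by positivity) hθ.ne',
      Real.log_div hk0.ne' hm0.ne', Real.log_div hl0.ne' hm0.ne', hlog4]
    have e2 : ∀ a b : ℝ, (m : ℝ) * (k / m * a + (m - k) / m * b) = k * a + (m - k) * b := by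
      intro a b
      field_simp
    rw [e2, hrm, hrk, hrl]
    ring

/-- Put `D = κ - θ` and expand around `κ / θ = 1 + D / θ` and `(1 - κ) / (1 - θ) = 1 - D / (1 - θ)`.
The linear terms `D` and `-D` cancel, and the quadratic ones add up to `D ^ 2 / (2 θ (1 - θ))`. The
radius `c / 2` keeps both relative deviations below `1 / 2`. -/
theorem abs_relative_entropy_sub_le {c θ κ : ℝ} (hc : 0 < c) (hcθ : c ≤ θ) (hθc : θ ≤ 1 - c)
    (hκ : |κ - θ| ≤ c / 2) :
    |κ * Real.log (κ / θ) + (1 - κ) * Real.log ((1 - κ) / (1 - θ)) -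
      (κ - θ) ^ 2 / (2 * θ * (1 - θ))| ≤ 8 / c ^ 3 * |κ - θ| ^ 3 ∧
    |Real.log (κ / θ) + Real.log ((1 - κ) / (1 - θ))| ≤ 4 / c * |κ - θ| := by
  have hθ0 : 0 < θ := hc.trans_le hcθ
  have hθ1 : c ≤ 1 - θ := by linarith
  have hθ1' : 0 < 1 - θ := hc.trans_le hθ1
  set D := κ - θ with hD
  have hDn := abs_nonneg D
  have small : ∀ τ : ℝ, c ≤ τ → |D| / τ ≤ |D| / c := fun τ hτ =>
    div_le_div_of_nonneg_left hDn hc hτ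
  have half : |D| / c ≤ 1 / 2 := by rw [div_le_iff₀ hc]; linarith
  have hy : |D / θ| = |D| / θ := by rw [abs_div, abs_of_pos hθ0]
  have hz : |-D / (1 - θ)| = |D| / (1 - θ) := by rw [abs_div, abs_of_pos hθ1', abs_neg]
  have ey : κ / θ = 1 + D / θ := by rw [hD]; field_simp; ring
  have ez : (1 - κ) / (1 - θ) = 1 + -D / (1 - θ) := by rw [hD]; field_simp; ring
  have hy' : |D / θ| ≤ 1 / 2 := by rw [hy]; exact (small θ hcθ).trans half
  have hz' : |-D / (1 - θ)| ≤ 1 / 2 := by rw [hz]; exact (small _ hθ1).trans half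
  rw [ey, ez]
  constructor
  · have a := abs_one_add_mul_log_one_add_sub_le hy'
    have b := abs_one_add_mul_log_one_add_sub_le hz'
    set A := (1 + D / θ) * Real.log (1 + D / θ) - D / θ - (D / θ) ^ 2 / 2 with hA
    set B := (1 + -D / (1 - θ)) * Real.log (1 + -D / (1 - θ)) - -D / (1 - θ) -
      (-D / (1 - θ)) ^ 2 / 2 with hB
    have e : κ * Real.log (1 + D / θ) + (1 - κ) * Real.log (1 + -D / (1 - θ)) -
        D ^ 2 / (2 * θ * (1 - θ)) = θ * A + (1 - θ) * B := by
      have e1 : θ * A = κ * Real.log (1 + D / θ) - D - D ^ 2 / (2 * θ) := by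
        rw [hA, ← ey]
        field_simp
      have e2 : (1 - θ) * B = (1 - κ) * Real.log (1 + -D / (1 - θ)) + D -
          D ^ 2 / (2 * (1 - θ)) := by
        rw [hB, ← ez]
        field_simp
        ring
      rw [e1, e2]
      field_simp
      ring
    have cube : ∀ τ : ℝ, c ≤ τ → 4 * (|D| / τ) ^ 3 ≤ 4 / c ^ 3 * |D| ^ 3 := fun τ hτ => by
      calc 4 * (|D| / τ) ^ 3 ≤ 4 * (|D| / c) ^ 3 := by
            have := small τ hτ
            have : 0 ≤ |D| / τ := div_nonneg hDn (hc.le.trans hτ)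
            gcongr
        _ = 4 / c ^ 3 * |D| ^ 3 := by rw [div_pow]; ring
    rw [hy] at a
    rw [hz] at b
    have a' := a.trans (cube θ hcθ)
    have b' := b.trans (cube _ hθ1)
    rw [e]
    calc |θ * A + (1 - θ) * B| ≤ |θ * A| + |(1 - θ) * B| := abs_add_le _ _
      _ = θ * |A| + (1 - θ) * |B| := by
        rw [abs_mul, abs_mul, abs_of_pos hθ0, abs_of_pos hθ1']
      _ ≤ θ * (4 / c ^ 3 * |D| ^ 3) + (1 - θ) * (4 / c ^ 3 * |D| ^ 3) := by gcongr
      _ = 4 / c ^ 3 * |D| ^ 3 := by ring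
      _ ≤ 8 / c ^ 3 * |D| ^ 3 := by gcongr; norm_num
  · have a := abs_log_one_add_le hy'
    have b := abs_log_one_add_le hz'
    rw [hy] at a
    rw [hz] at b
    have e : 4 / c * |D| = 4 * (|D| / c) := by ring
    rw [e]
    linarith [abs_add_le (Real.log (1 + D / θ)) (Real.log (1 + -D / (1 - θ))), small θ hcθ,
      small _ hθ1]

/-- With `y` the offset of `x` from the cell centre and `D = κ - θ`, the difference consists of the
cross term in `m y D` and the square term in `m y ^ 2`. Both are small because `|m y| ≤ 1`. -/
theorem abs_smoothing_sub_le {c θ κ x m : ℝ} (hc : 0 < c) (hcθ : c ≤ θ) (hθ1 : c ≤ 1 - θ)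
    (hm : 0 < m) (hx : |x - (2 * κ - 1)| ≤ 1 / m) :
    |m * (x - (2 * θ - 1)) ^ 2 / (8 * θ * (1 - θ)) - m * ((κ - θ) ^ 2 / (2 * θ * (1 - θ)))| ≤
      1 / c ^ 2 * |κ - θ| + 1 / c ^ 2 / m := by
  have hθ0 : 0 < θ := hc.trans_le hcθ
  have hθ1' : 0 < 1 - θ := hc.trans_le hθ1
  have hcc : c ^ 2 ≤ θ * (1 - θ) := by nlinarith
  obtain ⟨y, rfl⟩ : ∃ y, x = y + (2 * κ - 1) := ⟨x - (2 * κ - 1), by ring⟩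
  obtain ⟨D, rfl⟩ : ∃ D, κ = D + θ := ⟨κ - θ, by ring⟩
  rw [add_sub_cancel_right] at hx ⊢
  have e : m * (y + (2 * (D + θ) - 1) - (2 * θ - 1)) ^ 2 / (8 * θ * (1 - θ)) -
      m * (D ^ 2 / (2 * θ * (1 - θ))) = (m * y * D + m * y * y / 4) / (2 * (θ * (1 - θ))) := by
    field_simp
    ring
  have hmy : |m * y| ≤ 1 := by
    rw [abs_mul, abs_of_pos hm]
    calc m * |y| ≤ m * (1 / m) := by gcongr
      _ = 1 := by field_simp
  have hnum : |m * y * D + m * y * y / 4| ≤ |D| + 1 / m := by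
    calc |m * y * D + m * y * y / 4| ≤ |m * y * D| + |m * y * y / 4| := abs_add_le _ _
      _ = |m * y| * |D| + |m * y| * |y| / 4 := by
        rw [abs_mul (m * y) D, abs_div, abs_mul (m * y) y]; norm_num
      _ ≤ 1 * |D| + 1 * (1 / m) / 4 := by gcongr
      _ ≤ |D| + 1 / m := by
        have : 0 < 1 / m := by positivity
        linarith
  rw [e, abs_div, abs_of_pos (a := 2 * (θ * (1 - θ))) (by positivity)]
  calc _ ≤ (|D| + 1 / m) / c ^ 2 := by
        apply div_le_div₀ (by positivity) hnum (by positivity)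
        nlinarith
    _ = 1 / c ^ 2 * |D| + 1 / c ^ 2 / m := by ring

/-- In terms of `q = m D ^ 2`, the squares of the three terms are `q ^ 3 / m`, `q / m` and at most
`1 / m`. A sixth moment of the standardized deviation is therefore all that is needed later. -/
theorem sq_le_of_abs_le_cubic {u K D m : ℝ} (hm : 1 ≤ m)
    (hu : |u| ≤ K * (m * |D| ^ 3 + |D| + 1 / m)) :
    u ^ 2 ≤ 6 * K ^ 2 * (1 + (m * D ^ 2) ^ 3) / m := by
  have hm0 : 0 < m := by linarith
  have hsq : u ^ 2 ≤ (K * (m * |D| ^ 3 + |D| + 1 / m)) ^ 2 := by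
    rw [← sq_abs]
    gcongr
  refine hsq.trans ?_
  obtain ⟨q, hq⟩ : ∃ q, q = m * D ^ 2 := ⟨_, rfl⟩
  rw [← hq]
  have hq0 : 0 ≤ q := by rw [hq]; positivity
  have a1 : (m * |D| ^ 3) ^ 2 = q ^ 3 / m := by
    have : |D| ^ 6 = D ^ 6 := by rw [Even.pow_abs (by decide)]
    rw [mul_pow, ← pow_mul, this, hq]
    field_simp
  have a2 : |D| ^ 2 = q / m := by rw [sq_abs, hq]; field_simp
  have a3 : (1 / m) ^ 2 ≤ 1 / m := by
    rw [div_pow, one_pow, sq]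
    gcongr
    nlinarith
  have a4 : ∀ a b d : ℝ, (a + b + d) ^ 2 ≤ 3 * (a ^ 2 + b ^ 2 + d ^ 2) := fun a b d => by
    nlinarith [sq_nonneg (a - b), sq_nonneg (b - d), sq_nonneg (a - d)]
  have a5 : q ≤ 1 + q ^ 3 := by
    rcases le_total q 1 with h | h
    · linarith [pow_nonneg hq0 3]
    · have : q ≤ q ^ 3 := le_self_pow₀ h (by norm_num)
      linarith
  calc (K * (m * |D| ^ 3 + |D| + 1 / m)) ^ 2
      = K ^ 2 * (m * |D| ^ 3 + |D| + 1 / m) ^ 2 := by rw [mul_pow]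
    _ ≤ K ^ 2 * (3 * (q ^ 3 / m + q / m + 1 / m)) := by
      gcongr
      refine (a4 _ _ _).trans ?_
      rw [a1, a2]
      linarith
    _ = K ^ 2 * (3 * (q ^ 3 + q + 1) / m) := by ring
    _ ≤ K ^ 2 * (3 * (q ^ 3 + (1 + q ^ 3) + 1) / m) := by gcongr
    _ = 6 * K ^ 2 * (1 + q ^ 3) / m := by ring

/-- Bookkeeping for `exists_log_ratio_eq`: `E` is the relative entropy, `F` its quadratic
approximation, `S` the normal exponent, `W` the variance term and `r` the Stirling remainder. The
leading terms `m F` cancel. -/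
theorem abs_sum_le_cubic {a b d m D E F S W r : ℝ} (ha : 0 ≤ a) (hb : 0 ≤ b) (hd : 0 ≤ d)
    (hm : 0 < m) (hD : 0 ≤ D) (hE : |E - F| ≤ a * D ^ 3) (hS : |S - m * F| ≤ b * D + b / m)
    (hW : |W| ≤ d * D) (hr : |r| ≤ (d + 1) / m) :
    |-(m * E) + S - W / 2 + r| ≤ (a + b + d + 1) * (m * D ^ 3 + D + 1 / m) := by
  have h1 : |m * (E - F)| ≤ m * (a * D ^ 3) := by
    rw [abs_mul, abs_of_pos hm]
    gcongr
  have h3 : (a + b + d + 1) * (m * D ^ 3 + D + 1 / m) =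
      m * (a * D ^ 3) + (b * D + b / m) + d * D + (d + 1) / m +
      ((b + d + 1) * (m * D ^ 3) + (a + 1) * D + a / m) := by ring
  have p : 0 ≤ (b + d + 1) * (m * D ^ 3) + (a + 1) * D + a / m := by positivity
  have e : -(m * E) + S - W / 2 + r = -(m * (E - F)) + (S - m * F) - W / 2 + r := by ring
  rw [h3, e]
  rw [abs_le] at *
  have q := mul_nonneg hd hD
  constructor <;> linarith [h1.1, h1.2, hS.1, hS.2, hW.1, hW.2, hr.1, hr.2]

theorem exists_sq_log_ratio_le {c : ℝ} (hc : 0 < c) : ∃ K : ℝ, 0 < K ∧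
    ∀ (m k : ℕ), 0 < k → k < m → ∀ θ : ℝ, c ≤ θ → θ ≤ 1 - c → |(k : ℝ) / m - θ| ≤ c / 2 →
    ∀ (v : ℝ≥0), (v : ℝ) = 4 * θ * (1 - θ) / m → ∀ x : ℝ, |x - (2 * (k / m) - 1)| ≤ 1 / m →
      (Real.log (m / 2 * binomialWeight m θ k) -
        Real.log (gaussianPDFReal (2 * θ - 1) v x)) ^ 2 ≤
        K * (1 + (m * (k / m - θ) ^ 2) ^ 3) / m := by
  refine ⟨6 * (8 / c ^ 3 + 1 / c ^ 2 + 4 / c + 1) ^ 2, by positivity, ?_⟩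
  intro m k hk hkm θ hcθ hθc hκ v hv x hx
  have hm1 : (1 : ℝ) ≤ m := by exact_mod_cast (by omega : 1 ≤ m)
  have hm0 : (0 : ℝ) < m := by linarith
  have hθ1 : c ≤ 1 - θ := by linarith
  obtain ⟨r, hr, hlog⟩ := exists_log_ratio_eq hk hkm (hc.trans_le hcθ) (by linarith) hv x
  obtain ⟨hent, hvar⟩ := abs_relative_entropy_sub_le hc hcθ hθc hκ
  have hD' := abs_le.1 hκ
  -- Both `k / m` and `1 - k / m` are at least `c / 2`, so `1 / k` and `1 / (m - k)` are at most `(2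
  -- / c) / m`.
  have hr' : |r| ≤ (4 / c + 1) / m := by
    have hkκ : (k : ℝ) = m * (k / m) := by field_simp
    have bound : ∀ κ : ℝ, c / 2 ≤ κ → 1 / (m * κ) ≤ 2 / c / m := fun κ h => by
      have : 0 < κ := by linarith
      rw [div_div, div_le_div_iff₀ (by positivity) (by positivity)]
      have := mul_le_mul_of_nonneg_left h hm0.le
      linarith
    have a := bound (k / m) (by linarith)
    have b := bound (1 - k / m) (by linarith)
    rw [← hkκ] at a
    rw [mul_sub, mul_one, ← hkκ] at b
    have : (4 / c + 1) / m = 2 / c / m + 2 / c / m + 1 / m := by ring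
    linarith
  have hsmooth := abs_smoothing_sub_le hc hcθ hθ1 hm0 hx
  refine sq_le_of_abs_le_cubic hm1 ?_
  rw [hlog]
  exact abs_sum_le_cubic (by positivity) (by positivity) (by positivity) hm0 (abs_nonneg _) hent
    hsmooth hvar hr'

/-- With `a = √p ≥ b = √q`, the arithmetic mean exceeds the geometric one by `(a - b) ^ 2 / 2`, and
`a - b ≤ a (log a - log b)`. Since `log a - log b` is half the log ratio of `p` and `q`, this gives
the factor `1 / 4`. No bound on the size of the ratio is required. -/
theorem half_add_mul_le_sqrt_mul {p q : ℝ} (hp : 0 < p) (hq : 0 < q) :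
    (p + q) / 2 * (1 - (Real.log p - Real.log q) ^ 2 / 4) ≤ √(p * q) := by
  wlog hpq : q ≤ p generalizing p q
  · have := this hq hp (le_of_not_ge hpq)
    rw [add_comm, mul_comm p q]
    convert this using 3
    ring
  set a := √p with ha
  set b := √q with hb
  have ha0 : 0 < a := Real.sqrt_pos.2 hp
  have hb0 : 0 < b := Real.sqrt_pos.2 hq
  have hab : b ≤ a := Real.sqrt_le_sqrt hpq
  have hpa : p = a ^ 2 := (Real.sq_sqrt hp.le).symm
  have hqb : q = b ^ 2 := (Real.sq_sqrt hq.le).symm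
  rw [Real.sqrt_mul hp.le, ← ha, ← hb, hpa, hqb, Real.log_pow, Real.log_pow]
  set u := Real.log a - Real.log b with hu
  have hu0 : 0 ≤ u := sub_nonneg.2 (Real.log_le_log hb0 hab)
  have h1 : 1 - b / a ≤ u := by
    have := Real.one_sub_inv_le_log_of_pos (div_pos ha0 hb0)
    rwa [inv_div, Real.log_div ha0.ne' hb0.ne'] at this
  have h2 : a - b ≤ u * a := by
    have := mul_le_mul_of_nonneg_right h1 ha0.le
    rwa [sub_mul, one_mul, div_mul_cancel₀ _ ha0.ne'] at this
  have h3 : (a - b) ^ 2 ≤ (u * a) ^ 2 := by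
    have : 0 ≤ a - b := sub_nonneg.2 hab
    gcongr
  have e : ((2 : ℕ) : ℝ) * Real.log a - (2 : ℕ) * Real.log b = 2 * u := by
    rw [hu]; push_cast; ring
  rw [e]
  nlinarith [mul_nonneg (sq_nonneg u) (sq_nonneg b)]

end LocalLimit

/-! ### Sixth moments -/

section Moments

theorem pow_six_le_exp_add_exp (w : ℝ) : w ^ 6 ≤ 720 * (Real.exp w + Real.exp (-w)) := by
  have h := Real.pow_div_factorial_le_exp |w| (abs_nonneg w) 6
  rw [Even.pow_abs (by decide), div_le_iff₀ (by positivity)] at h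
  norm_num [Nat.factorial] at h
  have h' : Real.exp |w| ≤ Real.exp w + Real.exp (-w) := by
    rcases abs_choice w with e | e <;> rw [e] <;>
      linarith [Real.exp_pos w, Real.exp_pos (-w)]
  linarith

theorem binomialWeight_nonneg {θ : ℝ} (h0 : 0 ≤ θ) (h1 : θ ≤ 1) (m k : ℕ) :
    0 ≤ binomialWeight m θ k := by
  have : 0 ≤ 1 - θ := by linarith
  rw [binomialWeight]
  positivity

theorem sum_binomialWeight (m : ℕ) (θ : ℝ) :
    ∑ k ∈ Finset.range (m + 1), binomialWeight m θ k = 1 := by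
  have h := add_pow θ (1 - θ) m
  rw [add_sub_cancel, one_pow] at h
  rw [h]
  exact Finset.sum_congr rfl fun k _ => by rw [binomialWeight]; ring

/-- The exponential moment factors into an `m`-th power. In one factor, `exp y ≤ 1 + y + y ^ 2` for
`|y| ≤ 1` applies, and centring removes the linear term. -/
theorem sum_binomialWeight_mul_exp_le {θ s : ℝ} (h0 : 0 ≤ θ) (h1 : θ ≤ 1) (hs : |s| ≤ 1) (m : ℕ) :
    ∑ k ∈ Finset.range (m + 1), binomialWeight m θ k * Real.exp (s * (k - m * θ)) ≤
      Real.exp (m * s ^ 2) := by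
  have h1' : 0 ≤ 1 - θ := by linarith
  have e : ∑ k ∈ Finset.range (m + 1), binomialWeight m θ k * Real.exp (s * (k - m * θ)) =
      (θ * Real.exp (s * (1 - θ)) + (1 - θ) * Real.exp (-(s * θ))) ^ m := by
    rw [add_pow]
    refine Finset.sum_congr rfl fun k hk => ?_
    have hkm : k ≤ m := Nat.lt_succ_iff.1 (Finset.mem_range.1 hk)
    rw [mul_pow, mul_pow, ← Real.exp_nat_mul, ← Real.exp_nat_mul, binomialWeight,
      Nat.cast_sub hkm]
    have : s * (k - m * θ) = k * (s * (1 - θ)) + (m - k) * -(s * θ) := by ring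
    rw [this, Real.exp_add]
    ring
  have quad : ∀ y : ℝ, |y| ≤ 1 → Real.exp y ≤ 1 + y + y ^ 2 := fun y hy => by
    have := (abs_le.1 (Real.abs_exp_sub_one_sub_id_le hy)).2
    linarith
  have a := quad (s * (1 - θ)) (by
    rw [abs_mul, abs_of_nonneg h1']
    exact mul_le_one₀ hs h1' (by linarith))
  have b := quad (-(s * θ)) (by
    rw [abs_neg, abs_mul, abs_of_nonneg h0]
    exact mul_le_one₀ hs h0 h1)
  have hbase : θ * Real.exp (s * (1 - θ)) + (1 - θ) * Real.exp (-(s * θ)) ≤ Real.exp (s ^ 2) := by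
    calc θ * Real.exp (s * (1 - θ)) + (1 - θ) * Real.exp (-(s * θ))
        ≤ θ * (1 + s * (1 - θ) + (s * (1 - θ)) ^ 2) +
          (1 - θ) * (1 + -(s * θ) + (-(s * θ)) ^ 2) := by gcongr
      _ = s ^ 2 * (θ * (1 - θ)) + 1 := by ring
      _ ≤ s ^ 2 * 1 + 1 := by
        gcongr
        exact mul_le_one₀ h1 h1' (by linarith)
      _ ≤ Real.exp (s ^ 2) := by rw [mul_one]; exact Real.add_one_le_exp _
  rw [e, Real.exp_nat_mul]
  gcongr

/-- The exponential moments of the deviation at `±1 / √m` are at most `e < 3`, and `w ^ 6 ≤ 6! (exp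
w + exp (-w))`; hence `4320 = 720 * (3 + 3)`. -/
theorem sum_binomialWeight_mul_pow_six_le {θ : ℝ} (h0 : 0 ≤ θ) (h1 : θ ≤ 1) {m : ℕ} (hm : 0 < m) :
    ∑ k ∈ Finset.range (m + 1), binomialWeight m θ k * ((m : ℝ) * (k / m - θ) ^ 2) ^ 3 ≤ 4320 := by
  have hm0 : (0 : ℝ) < m := by exact_mod_cast hm
  have hm1 : (1 : ℝ) ≤ m := by exact_mod_cast hm
  set s : ℝ := (√m)⁻¹ with hs
  have hs2 : (m : ℝ) * s ^ 2 = 1 := by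
    rw [hs, inv_pow, Real.sq_sqrt hm0.le, mul_inv_cancel₀ hm0.ne']
  have hs1 : |s| ≤ 1 := by
    rw [hs, abs_of_nonneg (by positivity)]
    exact inv_le_one_of_one_le₀ (Real.one_le_sqrt.2 hm1)
  have a := sum_binomialWeight_mul_exp_le h0 h1 hs1 m
  have b := sum_binomialWeight_mul_exp_le h0 h1 (by rwa [abs_neg]) m (s := -s)
  rw [neg_sq, hs2] at b
  rw [hs2] at a
  have key : ∀ k : ℕ, ((m : ℝ) * (k / m - θ) ^ 2) ^ 3 ≤
      720 * (Real.exp (s * (k - m * θ)) + Real.exp (-s * (k - m * θ))) := fun k => by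
    have e : ((m : ℝ) * (k / m - θ) ^ 2) ^ 3 = (s * (k - m * θ)) ^ 6 := by
      have e1 : (m : ℝ) * (k / m - θ) ^ 2 = (s * (k - m * θ)) ^ 2 := by
        have : s ^ 2 = 1 / m := by
          field_simp
          linarith
        rw [mul_pow, this]
        field_simp
      rw [e1, ← pow_mul]
    rw [e, neg_mul]
    exact pow_six_le_exp_add_exp _
  calc _ ≤ ∑ k ∈ Finset.range (m + 1), binomialWeight m θ k *
        (720 * (Real.exp (s * (k - m * θ)) + Real.exp (-s * (k - m * θ)))) :=
        Finset.sum_le_sum fun k _ =>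
          mul_le_mul_of_nonneg_left (key k) (binomialWeight_nonneg h0 h1 m k)
    _ = 720 * (∑ k ∈ Finset.range (m + 1), binomialWeight m θ k * Real.exp (s * (k - m * θ)) +
        ∑ k ∈ Finset.range (m + 1), binomialWeight m θ k * Real.exp (-s * (k - m * θ))) := by
      rw [← Finset.sum_add_distrib, Finset.mul_sum]
      exact Finset.sum_congr rfl fun k _ => by ring
    _ ≤ 4320 := by linarith [Real.exp_one_lt_three]

theorem gaussianReal_pow_six {t : ℝ} {v : ℝ≥0} {m : ℕ} (hv : m * (v : ℝ) ≤ 2) :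
    Integrable (fun x => ((m : ℝ) * (x - t) ^ 2) ^ 3) (gaussianReal t v) ∧
      ∫ x, ((m : ℝ) * (x - t) ^ 2) ^ 3 ∂(gaussianReal t v) ≤ 4320 := by
  have hexp : ∀ s : ℝ, Integrable (fun x => Real.exp (s * (x - t))) (gaussianReal t v) ∧
      ∫ x, Real.exp (s * (x - t)) ∂(gaussianReal t v) = Real.exp (v * s ^ 2 / 2) := fun s => by
    have e : (fun x => Real.exp (s * (x - t))) = fun x => Real.exp (-(s * t)) * Real.exp (s * x) := by
      ext x
      rw [← Real.exp_add]
      ring_nf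
    have h := congrFun (mgf_fun_id_gaussianReal (μ := t) (v := v)) s
    rw [mgf] at h
    rw [e]
    refine ⟨(integrable_exp_mul_gaussianReal s).const_mul _, ?_⟩
    rw [integral_const_mul, h, ← Real.exp_add]
    ring_nf
  have hmv : ∀ s : ℝ, s ^ 2 = m → Real.exp (v * s ^ 2 / 2) ≤ 3 := fun s hs => by
    refine le_trans (Real.exp_le_exp.2 ?_) Real.exp_one_lt_three.le
    rw [hs]
    linarith
  obtain ⟨i1, e1⟩ := hexp (√m)
  obtain ⟨i2, e2⟩ := hexp (-√m)
  have hsq : √(m : ℝ) ^ 2 = m := Real.sq_sqrt (Nat.cast_nonneg m)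
  have key : ∀ x : ℝ, ((m : ℝ) * (x - t) ^ 2) ^ 3 ≤
      720 * (Real.exp (√m * (x - t)) + Real.exp (-√m * (x - t))) := fun x => by
    have e : ((m : ℝ) * (x - t) ^ 2) ^ 3 = (√m * (x - t)) ^ 6 := by
      have : (m : ℝ) * (x - t) ^ 2 = (√m * (x - t)) ^ 2 := by rw [mul_pow, hsq]
      rw [this, ← pow_mul]
    rw [e, neg_mul]
    exact pow_six_le_exp_add_exp _
  have hint := (i1.add i2).const_mul 720
  have hi : Integrable (fun x => ((m : ℝ) * (x - t) ^ 2) ^ 3) (gaussianReal t v) := by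
    refine hint.mono' (by fun_prop) (ae_of_all _ fun x => ?_)
    rw [Real.norm_eq_abs, abs_of_nonneg (by positivity)]
    exact key x
  refine ⟨hi, (integral_mono hi hint key).trans ?_⟩
  simp only [Pi.add_apply]
  rw [integral_const_mul, integral_add i1 i2, e1, e2]
  have := hmv (√m) hsq
  have := hmv (-√m) (by rw [neg_sq, hsq])
  linarith

end Moments

/-! ### Smoothed binomial and normal distributions -/

section Smoothing

/-- The law of `2 K / m - 1` where `K` is binomial with parameters `m` and `θ`. -/
def binomialLaw (m : ℕ) (θ : ℝ) : Measure ℝ :=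
  ∑ k ∈ Finset.range (m + 1), ENNReal.ofReal (binomialWeight m θ k) •
    Measure.dirac (2 * ((k : ℝ) / m) - 1)

/-- The uniform distribution on `[-1, 1)`. -/
def uniformNoise : Measure ℝ :=
  (2⁻¹ : ℝ≥0∞) • volume.restrict (Set.Ico (-1) 1)

instance : IsProbabilityMeasure uniformNoise :=
  ⟨by
    simp only [uniformNoise, Measure.smul_apply, Measure.restrict_apply_univ, Real.volume_Ico,
      smul_eq_mul]
    norm_num
    exact ENNReal.inv_mul_cancel two_ne_zero ENNReal.ofNat_ne_top⟩

/-- Adding noise of size `1 / m`, except at the points `1` and `-1`. -/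
def smear (m : ℕ) (z : ℝ × ℝ) : ℝ :=
  if z.1 = 1 ∨ z.1 = -1 then z.1 else z.1 + z.2 / m

theorem measurable_smear (m : ℕ) : Measurable (smear m) := by
  refine Measurable.ite ?_ (by fun_prop) (by fun_prop)
  exact ((measurableSet_singleton (1 : ℝ)).union (measurableSet_singleton (-1))).preimage
    measurable_fst

/-- The interval of length `2 / m` around `2 k / m - 1`. -/
def cell (m k : ℕ) : Set ℝ :=
  Set.Ico (2 * ((k : ℝ) / m) - 1 - 1 / m) (2 * ((k : ℝ) / m) - 1 + 1 / m)

theorem measurableSet_cell (m k : ℕ) : MeasurableSet (cell m k) := measurableSet_Ico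

theorem volume_cell {m : ℕ} (hm : 0 < m) (k : ℕ) :
    volume.real (cell m k) = 2 / m := by
  have hm0 : (0 : ℝ) < m := by exact_mod_cast hm
  rw [cell, Real.volume_real_Ico_of_le]
  · ring
  · have : 0 < 1 / (m : ℝ) := by positivity
    linarith

theorem eq_of_mem_cell {m k k' : ℕ} (hm : 0 < m) {x : ℝ} (h : x ∈ cell m k) (h' : x ∈ cell m k') :
    k = k' := by
  have hm0 : (0 : ℝ) < m := by exact_mod_cast hm
  have key : ∀ k k' : ℕ, x ∈ cell m k → x ∈ cell m k' → k ≤ k' := fun k k' h h' => by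
    have h1 : 2 * ((k : ℝ) / m) - 1 - 1 / m < 2 * ((k' : ℝ) / m) - 1 + 1 / m := h.1.trans_lt h'.2
    have h2 : ((k : ℝ)) < k' + 1 := by
      have : (k : ℝ) / m < (k' + 1) / m := by
        rw [add_div]
        linarith
      exact (div_lt_div_iff_of_pos_right hm0).1 this
    have : k < k' + 1 := by exact_mod_cast h2
    omega
  exact le_antisymm (key _ _ h h') (key _ _ h' h)

/-- The noise scaled by `1 / m` carries `[-1, 1)` onto the cell, on which it has constant density `m
/ 2`. -/
theorem uniformNoise_preimage {m : ℕ} (hm : 0 < m) (k : ℕ) {A : Set ℝ} (hA : MeasurableSet A) :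
    uniformNoise {u | 2 * ((k : ℝ) / m) - 1 + u / m ∈ A} =
      ENNReal.ofReal (m / 2) * volume (A ∩ cell m k) := by
  have hm0 : (0 : ℝ) < m := by exact_mod_cast hm
  set s : ℝ := 2 * ((k : ℝ) / m) - 1 with hs
  have hset : {u : ℝ | s + u / m ∈ A} ∩ Set.Ico (-1) 1 =
      (fun u => (m : ℝ)⁻¹ * u) ⁻¹' ((fun y => s + y) ⁻¹' (A ∩ cell m k)) := by
    ext u
    simp only [Set.mem_inter_iff, Set.mem_ofPred_eq, Set.mem_preimage, cell, Set.mem_Ico, ← hs,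
      inv_mul_eq_div]
    refine and_congr_right fun _ => ?_
    rw [sub_eq_add_neg, add_le_add_iff_left, add_lt_add_iff_left, ← neg_div,
      div_le_div_iff_of_pos_right hm0, div_lt_div_iff_of_pos_right hm0]
  have hAm : MeasurableSet {u : ℝ | s + u / m ∈ A} := by
    have : Measurable fun u : ℝ => s + u / m := by fun_prop
    exact this hA
  rw [uniformNoise, Measure.smul_apply, Measure.restrict_apply hAm, hset,
    Real.volume_preimage_mul_left (inv_ne_zero hm0.ne'), inv_inv, abs_of_pos hm0,
    measure_preimage_add, smul_eq_mul, ← mul_assoc]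
  congr 1
  rw [div_eq_inv_mul, ENNReal.ofReal_mul (by norm_num), ENNReal.ofReal_inv_of_pos two_pos]
  norm_num

theorem isProbabilityMeasure_binomialLaw {θ : ℝ} (h0 : 0 ≤ θ) (h1 : θ ≤ 1) (m : ℕ) :
    IsProbabilityMeasure (binomialLaw m θ) := by
  refine ⟨?_⟩
  simp only [binomialLaw, Measure.finsetSum_apply, Measure.smul_apply, measure_univ, smul_eq_mul,
    mul_one]
  rw [← ENNReal.ofReal_sum_of_nonneg fun k _ => binomialWeight_nonneg h0 h1 m k,
    sum_binomialWeight, ENNReal.ofReal_one]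

theorem smear_law_apply (m : ℕ) (θ : ℝ) {A : Set ℝ} (hA : MeasurableSet A) :
    ((binomialLaw m θ).prod uniformNoise).map (smear m) A =
      ∑ k ∈ Finset.range (m + 1), ENNReal.ofReal (binomialWeight m θ k) *
        uniformNoise {u | smear m (2 * ((k : ℝ) / m) - 1, u) ∈ A} := by
  rw [Measure.map_apply (measurable_smear m) hA, Measure.prod_apply (measurable_smear m hA),
    binomialLaw, lintegral_finsetSum_measure]
  refine Finset.sum_congr rfl fun k _ => ?_
  rw [lintegral_smul_measure, lintegral_dirac]
  rfl

/-- The density of the law of a smoothed binomial variable on the union of the cells with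
indices in `S`. -/
def cellDensity (m : ℕ) (θ : ℝ) (S : Finset ℕ) (x : ℝ) : ℝ≥0 :=
  ∑ k ∈ S, (cell m k).indicator (fun _ => (m / 2 * binomialWeight m θ k).toNNReal) x

theorem measurable_cellDensity (m : ℕ) (θ : ℝ) (S : Finset ℕ) : Measurable (cellDensity m θ S) :=
  Finset.measurable_fun_sum _ fun k _ => measurable_const.indicator (measurableSet_cell m k)

theorem cellDensity_of_mem {m : ℕ} (hm : 0 < m) {θ : ℝ} {S : Finset ℕ} {k : ℕ} (hk : k ∈ S) {x : ℝ}
    (hx : x ∈ cell m k) : cellDensity m θ S x = (m / 2 * binomialWeight m θ k).toNNReal := by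
  rw [cellDensity, Finset.sum_eq_single k, Set.indicator_of_mem hx]
  · intro j _ hj
    exact Set.indicator_of_notMem (fun h => hj (eq_of_mem_cell hm h hx)) _
  · exact fun h => absurd hk h

/-- Only domination is claimed: `smear` keeps atoms at `1` and `-1`, that is at `k = m` and `k = 0`,
which `S` excludes. -/
theorem withDensity_cellDensity_le {m : ℕ} (hm : 0 < m) {θ : ℝ} {S : Finset ℕ}
    (hS : ∀ k ∈ S, 0 < k ∧ k < m) :
    volume.withDensity (fun x => (cellDensity m θ S x : ℝ≥0∞)) ≤
      ((binomialLaw m θ).prod uniformNoise).map (smear m) := by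
  have hm0 : (0 : ℝ) < m := by exact_mod_cast hm
  refine Measure.le_iff.2 fun A hA => ?_
  rw [smear_law_apply m θ hA, withDensity_apply _ hA]
  simp only [cellDensity, ENNReal.ofNNReal_finsetSum]
  rw [lintegral_finsetSum _ fun k _ =>
    (measurable_const.indicator (measurableSet_cell m k)).coe_nnreal_ennreal]
  have hsub : S ⊆ Finset.range (m + 1) := fun k hk =>
    Finset.mem_range.2 ((hS k hk).2.trans (Nat.lt_succ_self m))
  refine le_trans (Finset.sum_le_sum fun k hk => ?_)
    (Finset.sum_le_sum_of_subset hsub)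
  obtain ⟨hk0, hkm⟩ := hS k hk
  have hs1 : 2 * ((k : ℝ) / m) - 1 ≠ 1 := fun h => by
    have : (k : ℝ) / m = 1 := by linarith
    rw [div_eq_one_iff_eq hm0.ne'] at this
    exact hkm.ne (by exact_mod_cast this)
  have hs2 : 2 * ((k : ℝ) / m) - 1 ≠ -1 := fun h => by
    have : (k : ℝ) / m = 0 := by linarith
    rw [div_eq_zero_iff] at this
    rcases this with h | h
    · exact hk0.ne' (by exact_mod_cast h)
    · exact hm0.ne' h
  have hset : {u | smear m (2 * ((k : ℝ) / m) - 1, u) ∈ A} =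
      {u | 2 * ((k : ℝ) / m) - 1 + u / m ∈ A} := by
    ext u
    simp [smear, hs1, hs2]
  rw [hset, uniformNoise_preimage hm k hA, ← mul_assoc,
    ← ENNReal.ofReal_mul' (by positivity), mul_comm (binomialWeight m θ k)]
  simp only [ENNReal.coe_indicator]
  rw [lintegral_indicator (measurableSet_cell m k), setLIntegral_const,
    Measure.restrict_apply (measurableSet_cell m k), Set.inter_comm]
  rfl

end Smoothing

/-! ### Hellinger affinity of the smoothed binomial and the normal law -/

section SmoothedBinomial

/-- The indices of the cells that are close to the mean of the binomial distribution. -/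
def centralIndices (m : ℕ) (θ c : ℝ) : Finset ℕ :=
  {k ∈ Finset.range (m + 1) | |(k : ℝ) / m - θ| ≤ c / 2}

theorem centralIndices_bounds {m : ℕ} (hm : 0 < m) {θ c : ℝ} (hc : 0 < c) (hcθ : c ≤ θ)
    (hθc : θ ≤ 1 - c) {k : ℕ} (hk : k ∈ centralIndices m θ c) : 0 < k ∧ k < m := by
  have hm0 : (0 : ℝ) < m := by exact_mod_cast hm
  obtain ⟨hkm, hk⟩ := Finset.mem_filter.1 hk
  have hkm : k ≤ m := Nat.lt_succ_iff.1 (Finset.mem_range.1 hkm)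
  rw [abs_le] at hk
  constructor
  · rcases Nat.eq_zero_or_pos k with rfl | h
    · simp at hk
      linarith
    · exact h
  · refine lt_of_le_of_ne hkm fun h => ?_
    rw [h, div_self hm0.ne'] at hk
    linarith

/-- Moves the error term from the cell centre to the point `x` itself, so that it can be integrated
against the normal law. The cube is handled by convexity. -/
theorem one_add_cube_le {m : ℕ} (hm : 0 < m) {κ θ x : ℝ} (hx : |x - (2 * κ - 1)| ≤ 1 / m) :
    1 + ((m : ℝ) * (κ - θ) ^ 2) ^ 3 ≤ 2 * (1 + ((m : ℝ) * (x - (2 * θ - 1)) ^ 2) ^ 3) := by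
  have hm1 : (1 : ℝ) ≤ m := by exact_mod_cast hm
  have hm0 : (0 : ℝ) < m := by linarith
  set y := x - (2 * κ - 1) with hy
  set z := (m : ℝ) * (x - (2 * θ - 1)) ^ 2 with hz
  have hz0 : 0 ≤ z := by positivity
  have hy2 : (m : ℝ) * y ^ 2 ≤ 1 := by
    have : y ^ 2 ≤ (1 / m) ^ 2 := by rw [← sq_abs]; gcongr
    calc (m : ℝ) * y ^ 2 ≤ m * (1 / m) ^ 2 := by gcongr
      _ = 1 / (m : ℝ) := by field_simp
      _ ≤ 1 := by rw [div_le_one hm0]; exact hm1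
  have h1 : (m : ℝ) * (κ - θ) ^ 2 ≤ (z + 1) / 2 := by
    have e : 2 * (κ - θ) = (x - (2 * θ - 1)) - y := by rw [hy]; ring
    have h2 : (2 * (κ - θ)) ^ 2 ≤ 2 * (x - (2 * θ - 1)) ^ 2 + 2 * y ^ 2 := by
      rw [e]; nlinarith [sq_nonneg (x - (2 * θ - 1) + y)]
    have := mul_le_mul_of_nonneg_left h2 hm0.le
    rw [hz]
    linarith
  have h3 : ((m : ℝ) * (κ - θ) ^ 2) ^ 3 ≤ ((z + 1) / 2) ^ 3 := by gcongr
  have h4 : ((z + 1) / 2) ^ 3 ≤ (z ^ 3 + 1) / 2 := by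
    nlinarith [mul_nonneg (add_nonneg hz0 zero_le_one) (sq_nonneg (z - 1))]
  have := pow_nonneg hz0 3
  linarith

theorem le_one_add_cube {q : ℝ} (hq : 0 ≤ q) : q ≤ 1 + q ^ 3 := by
  rcases le_total q 1 with h | h
  · linarith [pow_nonneg hq 3]
  · have : q ≤ q ^ 3 := le_self_pow₀ h (by norm_num)
    linarith

/-- Away from the central cells the remainder terms exceed one. -/
theorem one_le_of_notMem_cell {m : ℕ} (hm : 0 < m) {θ c x : ℝ} (hc : 0 < c) (hcθ : c ≤ θ)
    (hθc : θ ≤ 1 - c) (hx : ∀ k ∈ centralIndices m θ c, x ∉ cell m k) :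
    1 ≤ (2 / c + 4 / c ^ 2) * (1 + ((m : ℝ) * (x - (2 * θ - 1)) ^ 2) ^ 3) / m := by
  have hm0 : (0 : ℝ) < m := by exact_mod_cast hm
  set z := (m : ℝ) * (x - (2 * θ - 1)) ^ 2 with hz
  have hz0 : 0 ≤ z := by positivity
  have hz3 := pow_nonneg hz0 3
  rw [le_div_iff₀ hm0, one_mul]
  by_cases hmc : (m : ℝ) ≤ 2 / c
  · calc (m : ℝ) ≤ 2 / c := hmc
      _ ≤ (2 / c + 4 / c ^ 2) * 1 := by
        have : 0 < 4 / c ^ 2 := by positivity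
        linarith
      _ ≤ _ := by gcongr; linarith
  push Not at hmc
  by_cases hxt : c / 2 ≤ |x - (2 * θ - 1)|
  · have h1 : m * (c / 2) ^ 2 ≤ z := by
      rw [hz, ← sq_abs (x - (2 * θ - 1))]
      gcongr
    calc (m : ℝ) = 4 / c ^ 2 * (m * (c / 2) ^ 2) := by field_simp; norm_num
      _ ≤ 4 / c ^ 2 * (1 + z ^ 3) := by
        gcongr
        exact h1.trans (le_one_add_cube hz0)
      _ ≤ _ := by
        gcongr
        have : 0 < 2 / c := by positivity
        linarith
  · exfalso
    push Not at hxt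
    have hinv : 1 / (m : ℝ) < c / 2 := by
      rw [div_lt_iff₀ hc] at hmc
      rw [div_lt_div_iff₀ hm0 two_pos]
      linarith
    -- The index of the cell containing `x`. With `1 / m < c / 2` and `x` within `c / 2` of the mean
    -- `2 θ - 1`, this cell is central, a contradiction.
    set k : ℤ := ⌊(m * x + m + 1) / 2⌋ with hk
    have hk1 : (k : ℝ) ≤ (m * x + m + 1) / 2 := Int.floor_le _
    have hk2 : (m * x + m + 1) / 2 < k + 1 := Int.lt_floor_add_one _
    have hk1' : (k : ℝ) / m ≤ (x + 1 + 1 / m) / 2 := by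
      rw [div_le_iff₀ hm0]
      field_simp
      linarith
    have hk2' : (x + 1 + 1 / m) / 2 < (k : ℝ) / m + 1 / m := by
      rw [← add_div, lt_div_iff₀ hm0]
      field_simp
      linarith
    rw [abs_lt] at hxt
    have hcent : |(k : ℝ) / m - θ| ≤ c / 2 := by
      rw [abs_le]
      constructor <;> linarith
    have hk0 : 0 ≤ k := by
      have : 0 ≤ (k : ℝ) / m := by linarith [(abs_le.1 hcent).1]
      have := (div_nonneg_iff.1 this).resolve_right fun h => absurd h.2 (not_le.2 hm0)
      exact_mod_cast this.1
    obtain ⟨j, hj⟩ := Int.eq_ofNat_of_zero_le hk0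
    have hkj : (k : ℝ) = j := by rw [hj]; simp
    rw [hkj] at hcent hk1' hk2'
    have hjm : (j : ℝ) ≤ m := by
      have : (j : ℝ) / m ≤ 1 := by linarith [(abs_le.1 hcent).2]
      rwa [div_le_one hm0] at this
    refine hx j (Finset.mem_filter.2 ⟨Finset.mem_range.2 ?_, hcent⟩) ⟨?_, ?_⟩
    · have : j ≤ m := by exact_mod_cast hjm
      omega
    · linarith
    · linarith

/-- Enlarging `K` to `K + 4 / c ^ 2` makes every summand outside the central range nonpositive. The
central sum then dominates the full one, which the sixth moment evaluates; `4321` is `4320 + 1`. -/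
theorem sum_central_ge {m : ℕ} (hm : 0 < m) {θ c K : ℝ} (hc : 0 < c) (hcθ : c ≤ θ)
    (hθc : θ ≤ 1 - c) (hK : 0 ≤ K) :
    1 - (K + 4 / c ^ 2) * 4321 / m ≤ ∑ k ∈ centralIndices m θ c,
      binomialWeight m θ k * (1 - K * (1 + ((m : ℝ) * (k / m - θ) ^ 2) ^ 3) / m) := by
  have hm0 : (0 : ℝ) < m := by exact_mod_cast hm
  have h0 : 0 ≤ θ := hc.le.trans hcθ
  have h1 : θ ≤ 1 := by linarith
  set q : ℕ → ℝ := fun k => (m : ℝ) * (k / m - θ) ^ 2 with hq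
  have hq0 : ∀ k, 0 ≤ q k := fun k => by positivity
  set K' := K + 4 / c ^ 2 with hK'
  have hK'0 : 0 ≤ K' := by positivity
  have hKK' : K ≤ K' := by
    have : 0 < 4 / c ^ 2 := by positivity
    linarith
  have hmom := sum_binomialWeight_mul_pow_six_le h0 h1 hm
  have step1 : 1 - K' * 4321 / m ≤ ∑ k ∈ Finset.range (m + 1),
      binomialWeight m θ k * (1 - K' * (1 + q k ^ 3) / m) := by
    have e : ∑ k ∈ Finset.range (m + 1), binomialWeight m θ k * (1 - K' * (1 + q k ^ 3) / m) =
        (1 - K' / m) * ∑ k ∈ Finset.range (m + 1), binomialWeight m θ k -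
          K' / m * ∑ k ∈ Finset.range (m + 1), binomialWeight m θ k * q k ^ 3 := by
      rw [Finset.mul_sum, Finset.mul_sum, ← Finset.sum_sub_distrib]
      exact Finset.sum_congr rfl fun k _ => by ring
    rw [e, sum_binomialWeight]
    have : K' / m * ∑ k ∈ Finset.range (m + 1), binomialWeight m θ k * q k ^ 3 ≤ K' / m * 4320 := by
      gcongr
    have e2 : K' * 4321 / m = K' / m + K' / m * 4320 := by ring
    linarith
  refine step1.trans ?_
  have hsub : centralIndices m θ c ⊆ Finset.range (m + 1) := Finset.filter_subset _ _
  rw [← Finset.sum_sdiff hsub]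
  have hneg : ∑ k ∈ Finset.range (m + 1) \ centralIndices m θ c,
      binomialWeight m θ k * (1 - K' * (1 + q k ^ 3) / m) ≤ 0 := by
    refine Finset.sum_nonpos fun k hk => ?_
    refine mul_nonpos_of_nonneg_of_nonpos (binomialWeight_nonneg h0 h1 m k) ?_
    obtain ⟨hkr, hkc⟩ := Finset.mem_sdiff.1 hk
    have hfar : c / 2 < |(k : ℝ) / m - θ| := by
      by_contra h
      exact hkc (Finset.mem_filter.2 ⟨hkr, not_lt.1 h⟩)
    have hbig : m * (c / 2) ^ 2 ≤ q k := by
      simp only [hq]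
      rw [← sq_abs ((k : ℝ) / m - θ)]
      gcongr
    rw [sub_nonpos, le_div_iff₀ hm0, one_mul]
    calc (m : ℝ) = 4 / c ^ 2 * (m * (c / 2) ^ 2) := by field_simp; norm_num
      _ ≤ 4 / c ^ 2 * (1 + q k ^ 3) := by
        gcongr
        exact hbig.trans (le_one_add_cube (hq0 k))
      _ ≤ K' * (1 + q k ^ 3) := by
        have := pow_nonneg (hq0 k) 3
        gcongr
        linarith
  have hle : ∑ k ∈ centralIndices m θ c, binomialWeight m θ k * (1 - K' * (1 + q k ^ 3) / m) ≤
      ∑ k ∈ centralIndices m θ c, binomialWeight m θ k * (1 - K * (1 + q k ^ 3) / m) := by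
    refine Finset.sum_le_sum fun k _ => ?_
    have := binomialWeight_nonneg h0 h1 m k
    have := pow_nonneg (hq0 k) 3
    gcongr
  linarith

/-- On central cells `√(f φ) ≥ (f + φ) / 2 * (1 - e)`. The half with `f` is integrated as a binomial
sum (`F`), the half with `φ` as a normal integral (`H`), each by its own sixth moment. Off these
cells `F = 0` and `H ≤ 0`, so the same bound holds trivially. -/
theorem exists_hasAffinity_smoothed_binomial {c : ℝ} (hc : 0 < c) : ∃ C : ℝ, 0 < C ∧
    ∀ m : ℕ, 0 < m → ∀ θ : ℝ, c ≤ θ → θ ≤ 1 - c → ∀ v : ℝ≥0, (v : ℝ) = 4 * θ * (1 - θ) / m →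
      HasAffinity (((binomialLaw m θ).prod uniformNoise).map (smear m))
        (gaussianReal (2 * θ - 1) v) (ENNReal.ofReal (1 - C / m)) := by
  obtain ⟨K, hK0, hK⟩ := exists_sq_log_ratio_le hc
  -- The part `2 K` pays for `one_add_cube_le`, the rest makes `H` nonpositive off the central cells
  -- by `one_le_of_notMem_cell`.
  set K₂ := 2 * K + (2 / c + 4 / c ^ 2) with hK₂
  refine ⟨((K + 4 / c ^ 2) * 4321 + K₂ * 4321) / 2, by positivity, ?_⟩
  intro m hm θ hcθ hθc v hv
  have hm0 : (0 : ℝ) < m := by exact_mod_cast hm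
  have h0 : 0 < θ := hc.trans_le hcθ
  have h1 : 0 < 1 - θ := by linarith
  have hv0 : (0 : ℝ) < v := by rw [hv]; positivity
  have hv0' : v ≠ 0 := by
    rintro rfl
    simp at hv0
  set S := centralIndices m θ c with hS
  have hSb : ∀ k ∈ S, 0 < k ∧ k < m := fun k hk => centralIndices_bounds hm hc hcθ hθc hk
  set φ := gaussianPDFReal (2 * θ - 1) v with hφ
  have hφ0 : ∀ x, 0 < φ x := fun x => gaussianPDFReal_pos _ _ _ hv0'
  set f := cellDensity m θ S with hf
  set e : ℕ → ℝ := fun k => K * (1 + ((m : ℝ) * (k / m - θ) ^ 2) ^ 3) / m with he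
  set H : ℝ → ℝ := fun x => 1 - K₂ * (1 + ((m : ℝ) * (x - (2 * θ - 1)) ^ 2) ^ 3) / m with hH
  set F : ℝ → ℝ := fun x => ∑ k ∈ S,
    (cell m k).indicator (fun _ => m / 2 * binomialWeight m θ k * (1 - e k)) x with hF
  have hfm : Measurable f := measurable_cellDensity m θ S
  have hφm : Measurable φ := measurable_gaussianPDFReal _ _
  refine ⟨volume, inferInstance, f, fun x => (φ x).toNNReal, hfm, hφm.real_toNNReal,
    withDensity_cellDensity_le hm hSb, ?_, ?_⟩
  · rw [gaussianReal_of_var_ne_zero _ hv0']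
    exact le_rfl
  have hK₂0 : 0 < K₂ := by positivity
  have hpoint : ∀ x, F x / 2 + φ x * H x / 2 ≤ √(f x * φ x) := by
    intro x
    by_cases hx : ∃ k ∈ S, x ∈ cell m k
    · obtain ⟨k, hk, hxk⟩ := hx
      obtain ⟨hk0, hkm⟩ := hSb k hk
      set p : ℝ := m / 2 * binomialWeight m θ k with hp
      have hp0 : 0 < p := by
        have : (0 : ℝ) < m.choose k := by exact_mod_cast Nat.choose_pos hkm.le
        rw [hp, binomialWeight]
        positivity
      have hfx : (f x : ℝ) = p := by
        rw [hf, cellDensity_of_mem hm hk hxk, Real.coe_toNNReal _ hp0.le]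
      have hFx : F x = p * (1 - e k) := by
        simp only [hF]
        rw [Finset.sum_eq_single k, Set.indicator_of_mem hxk]
        · intro j _ hj
          exact Set.indicator_of_notMem (fun h => hj (eq_of_mem_cell hm h hxk)) _
        · exact fun h => absurd hk h
      have hxd : |x - (2 * ((k : ℝ) / m) - 1)| ≤ 1 / m := by
        rw [abs_le]
        constructor <;> linarith [hxk.1, hxk.2]
      have hu := hK m k hk0 hkm θ hcθ hθc (Finset.mem_filter.1 hk).2 v hv x hxd
      have hroot := half_add_mul_le_sqrt_mul hp0 (hφ0 x)
      have hHe : H x ≤ 1 - e k := by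
        simp only [hH, he]
        have h2 := one_add_cube_le hm (θ := θ) hxd
        have h3 : K * (1 + ((m : ℝ) * (k / m - θ) ^ 2) ^ 3) ≤
            K₂ * (1 + ((m : ℝ) * (x - (2 * θ - 1)) ^ 2) ^ 3) := by
          calc _ ≤ K * (2 * (1 + ((m : ℝ) * (x - (2 * θ - 1)) ^ 2) ^ 3)) := by gcongr
            _ = 2 * K * (1 + ((m : ℝ) * (x - (2 * θ - 1)) ^ 2) ^ 3) := by ring
            _ ≤ _ := by
              gcongr
              have : 0 < 2 / c + 4 / c ^ 2 := by positivity
              linarith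
        gcongr
      rw [hFx, hfx]
      refine le_trans ?_ hroot
      have hue : (Real.log p - Real.log (φ x)) ^ 2 / 4 ≤ e k := by
        have : (Real.log p - Real.log (φ x)) ^ 2 ≤ e k := hu
        have := sq_nonneg (Real.log p - Real.log (φ x))
        linarith
      calc p * (1 - e k) / 2 + φ x * H x / 2 ≤ p * (1 - e k) / 2 + φ x * (1 - e k) / 2 := by
            have := hφ0 x
            gcongr
        _ = (p + φ x) / 2 * (1 - e k) := by ring
        _ ≤ _ := by
          have := hφ0 x
          gcongr
    · push Not at hx
      have hFx : F x = 0 := Finset.sum_eq_zero fun k hk => Set.indicator_of_notMem (hx k hk) _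
      have hHx : H x ≤ 0 := by
        have h2 := one_le_of_notMem_cell hm hc hcθ hθc hx
        simp only [hH]
        rw [sub_nonpos]
        refine h2.trans ?_
        gcongr
        linarith
      rw [hFx, zero_div, zero_add]
      have : φ x * H x ≤ 0 := mul_nonpos_of_nonneg_of_nonpos (hφ0 x).le hHx
      have := Real.sqrt_nonneg ((f x : ℝ) * φ x)
      linarith
  have hcellInt : ∀ (k : ℕ) (r : ℝ), Integrable ((cell m k).indicator fun _ => r) := fun k r =>
    (integrable_indicator_iff (measurableSet_cell m k)).2
      (integrableOn_const (by rw [cell, Real.volume_Ico]; exact ENNReal.ofReal_ne_top))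
  have hfint : Integrable fun x => (f x : ℝ) := by
    have : (fun x => (f x : ℝ)) = fun x => ∑ k ∈ S, (cell m k).indicator
        (fun _ => ((m / 2 * binomialWeight m θ k).toNNReal : ℝ)) x := by
      ext x
      rw [hf, cellDensity, NNReal.coe_sum]
      exact Finset.sum_congr rfl fun k _ => by rw [NNReal.coe_indicator]
    rw [this]
    exact integrable_finsetSum _ fun k _ => hcellInt k _
  have hφint : Integrable φ := integrable_gaussianPDFReal _ _
  have hFint : Integrable F := integrable_finsetSum _ fun k _ => hcellInt k _
  have hsqrt_le : ∀ x, √(f x * φ x) ≤ f x + φ x := fun x => by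
    have a : (0 : ℝ) ≤ f x := (f x).2
    have b := (hφ0 x).le
    rw [Real.sqrt_le_left (by positivity)]
    nlinarith [mul_nonneg a b]
  have hrootint : Integrable fun x => √(f x * φ x) := by
    refine (hfint.add hφint).mono' ?_ (ae_of_all _ fun x => ?_)
    · exact (Measurable.sqrt (by fun_prop)).aestronglyMeasurable
    · rw [Real.norm_eq_abs, abs_of_nonneg (Real.sqrt_nonneg _)]
      exact hsqrt_le x
  obtain ⟨hzint, hzle⟩ := gaussianReal_pow_six (t := 2 * θ - 1) (v := v) (m := m) (by
    rw [hv, mul_div_cancel₀ _ hm0.ne']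
    nlinarith [sq_nonneg (2 * θ - 1)])
  have hRint : Integrable (fun x => K₂ * (1 + ((m : ℝ) * (x - (2 * θ - 1)) ^ 2) ^ 3) / m)
      (gaussianReal (2 * θ - 1) v) :=
    (((integrable_const _).add hzint).const_mul _).div_const _
  have hHint : Integrable H (gaussianReal (2 * θ - 1) v) := (integrable_const _).sub hRint
  have hHval : 1 - K₂ * 4321 / m ≤ ∫ x, φ x * H x := by
    have h2 : ∫ x, φ x * H x = ∫ x, H x ∂(gaussianReal (2 * θ - 1) v) := by
      rw [integral_gaussianReal_eq_integral_smul hv0']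
      rfl
    rw [h2]
    simp only [hH]
    rw [integral_sub (integrable_const _) hRint, integral_div,
      integral_const_mul, integral_add (integrable_const _) hzint]
    simp only [integral_const, probReal_univ, smul_eq_mul, mul_one]
    have : K₂ * (1 + ∫ x, ((m : ℝ) * (x - (2 * θ - 1)) ^ 2) ^ 3 ∂(gaussianReal (2 * θ - 1) v)) ≤
        K₂ * 4321 := by
      gcongr
      linarith
    have : K₂ * (1 + ∫ x, ((m : ℝ) * (x - (2 * θ - 1)) ^ 2) ^ 3 ∂(gaussianReal (2 * θ - 1) v)) / m ≤
        K₂ * 4321 / m := by gcongr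
    linarith
  have hφHint : Integrable fun x => φ x * H x := by
    rw [gaussianReal_of_var_ne_zero _ hv0', integrable_withDensity_iff_integrable_smul'
      (measurable_gaussianPDF _ _) (ae_of_all _ fun _ => gaussianPDF_lt_top)] at hHint
    refine hHint.congr (ae_of_all _ fun x => ?_)
    simp only [toReal_gaussianPDF, smul_eq_mul]
    rfl
  have hFval : 1 - (K + 4 / c ^ 2) * 4321 / m ≤ ∫ x, F x := by
    simp only [hF]
    rw [integral_finsetSum _ fun k _ => hcellInt k _]
    refine (sum_central_ge hm hc hcθ hθc hK0.le).trans (le_of_eq ?_)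
    refine Finset.sum_congr rfl fun k _ => ?_
    rw [integral_indicator (measurableSet_cell m k), setIntegral_const, volume_cell hm]
    simp only [smul_eq_mul, he]
    field_simp
  have hmain : 1 - ((K + 4 / c ^ 2) * 4321 + K₂ * 4321) / 2 / m ≤ ∫ x, √(f x * φ x) := by
    calc 1 - ((K + 4 / c ^ 2) * 4321 + K₂ * 4321) / 2 / m
        = (1 - (K + 4 / c ^ 2) * 4321 / m) / 2 + (1 - K₂ * 4321 / m) / 2 := by ring
      _ ≤ (∫ x, F x) / 2 + (∫ x, φ x * H x) / 2 := by gcongr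
      _ = ∫ x, (F x / 2 + φ x * H x / 2) := by
        rw [integral_add (hFint.div_const _) (hφHint.div_const _), integral_div, integral_div]
      _ ≤ ∫ x, √(f x * φ x) :=
        integral_mono ((hFint.div_const _).add (hφHint.div_const _)) hrootint hpoint
  refine (ENNReal.ofReal_le_ofReal hmain).trans (le_of_eq ?_)
  rw [ofReal_integral_eq_lintegral_ofReal hrootint (ae_of_all _ fun x => Real.sqrt_nonneg _)]
  refine lintegral_congr fun x => ?_
  rw [ENNReal.ofReal, ENNReal.coe_inj, ← NNReal.coe_inj, Real.coe_toNNReal _ (Real.sqrt_nonneg _),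
    Real.coe_sqrt, NNReal.coe_mul, Real.coe_toNNReal _ (hφ0 x).le]

end SmoothedBinomial

/-! ### Independent measurements with outcomes `1` and `-1` -/

section Sufficiency

variable {m : ℕ}

/-- The sequence with value `1` on `S` and `-1` elsewhere. -/
def arrangement (S : Finset (Fin m)) (i : Fin m) : ℝ := if i ∈ S then 1 else -1

theorem average_arrangement (hm : 0 < m) (S : Finset (Fin m)) :
    (∑ i, arrangement S i) / (m : ℝ) = 2 * ((S.card : ℝ) / m) - 1 := by
  have hm0 : (m : ℝ) ≠ 0 := by exact_mod_cast hm.ne'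
  have h : ∑ i, arrangement S i = 2 * S.card - m := by
    have e : ∀ i, arrangement S i = 2 * (if i ∈ S then 1 else 0) - 1 := fun i => by
      rw [arrangement]
      split_ifs <;> norm_num
    simp only [e, Finset.sum_sub_distrib, ← Finset.mul_sum]
    simp
  rw [h]
  field_simp

theorem pi_two_point (ν : Measure ℝ) [IsProbabilityMeasure ν] {a b : ℝ≥0∞}
    (hν : ν = a • Measure.dirac 1 + b • Measure.dirac (-1)) :
    (Measure.pi fun _ : Fin m => ν) = ∑ S : Finset (Fin m),
      (a ^ S.card * b ^ (m - S.card)) • Measure.dirac (arrangement S) := by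
  refine Measure.pi_eq fun s hs => ?_
  have hprod : ∀ i, ν (s i) = a * (s i).indicator 1 1 + b * (s i).indicator 1 (-1) := fun i => by
    rw [hν, Measure.add_apply, Measure.smul_apply, Measure.smul_apply,
      Measure.dirac_apply' _ (hs i), Measure.dirac_apply' _ (hs i), smul_eq_mul, smul_eq_mul]
  simp only [hprod]
  rw [Fintype.prod_add, Measure.finsetSum_apply]
  refine Finset.sum_congr rfl fun S _ => ?_
  rw [Measure.smul_apply, Measure.dirac_apply' _ (.univ_pi hs), smul_eq_mul,
    Finset.prod_mul_distrib, Finset.prod_mul_distrib, Finset.prod_const, Finset.prod_const,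
    Finset.card_compl, Fintype.card_fin]
  have hind : (Set.univ.pi s).indicator (1 : (Fin m → ℝ) → ℝ≥0∞) (arrangement S) =
      (∏ i ∈ S, (s i).indicator 1 (1 : ℝ)) * ∏ i ∈ Sᶜ, (s i).indicator 1 (-1 : ℝ) := by
    have e1 : ∏ i ∈ S, (s i).indicator (1 : ℝ → ℝ≥0∞) 1 =
        ∏ i ∈ S, (s i).indicator 1 (arrangement S i) :=
      Finset.prod_congr rfl fun i hi => by rw [arrangement, if_pos hi]
    have e2 : ∏ i ∈ Sᶜ, (s i).indicator (1 : ℝ → ℝ≥0∞) (-1) =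
        ∏ i ∈ Sᶜ, (s i).indicator 1 (arrangement S i) :=
      Finset.prod_congr rfl fun i hi => by rw [arrangement, if_neg (Finset.mem_compl.1 hi)]
    classical
    rw [e1, e2, Finset.prod_mul_prod_compl]
    simp only [Set.indicator_apply, Pi.one_apply, Fintype.prod_boole, Set.mem_univ_pi]
    split_ifs <;> rfl
  rw [hind]
  ring

/-- The average depends only on the number of outcomes `1`; collecting the sets of equal cardinality
produces the binomial coefficients. -/
theorem map_average_pi_two_point (hm : 0 < m) (ν : Measure ℝ) [IsProbabilityMeasure ν] {θ : ℝ}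
    (h0 : 0 ≤ θ) (h1 : θ ≤ 1) (hν : ν = ENNReal.ofReal θ • Measure.dirac 1 +
      ENNReal.ofReal (1 - θ) • Measure.dirac (-1)) :
    (Measure.pi fun _ : Fin m => ν).map (fun r => (∑ i, r i) / (m : ℝ)) = binomialLaw m θ := by
  have h1' : 0 ≤ 1 - θ := by linarith
  have hmeas : Measurable fun r : Fin m → ℝ => (∑ i, r i) / (m : ℝ) := by fun_prop
  rw [pi_two_point ν hν, map_sum_smul _ _ hmeas]
  simp only [Measure.map_dirac' hmeas, average_arrangement hm]
  rw [← Finset.powerset_univ, Finset.sum_powerset_apply_card fun k =>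
    (ENNReal.ofReal θ ^ k * ENNReal.ofReal (1 - θ) ^ (m - k)) •
      Measure.dirac (2 * ((k : ℝ) / m) - 1), binomialLaw, Finset.card_univ, Fintype.card_fin]
  refine Finset.sum_congr rfl fun k _ => ?_
  rw [binomialWeight, ENNReal.ofReal_mul (Nat.cast_nonneg _), ENNReal.ofReal_natCast,
    ENNReal.ofReal_mul (by positivity), ENNReal.ofReal_pow h0, ENNReal.ofReal_pow h1',
    ← Nat.cast_smul_eq_nsmul ℝ≥0∞, smul_smul]

instance : MeasurableSpace (Equiv.Perm (Fin m)) := ⊤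

/-- The uniform distribution on the permutations. -/
def uniformPerm (m : ℕ) : Measure (Equiv.Perm (Fin m)) :=
  ∑ π, (m.factorial : ℝ≥0∞)⁻¹ • Measure.dirac π

theorem sum_inv_factorial (m : ℕ) :
    ∑ _π : Equiv.Perm (Fin m), (m.factorial : ℝ≥0∞)⁻¹ = 1 := by
  rw [Finset.sum_const, Finset.card_univ, Fintype.card_perm, Fintype.card_fin, nsmul_eq_mul]
  exact ENNReal.mul_inv_cancel (by exact_mod_cast m.factorial_ne_zero) (ENNReal.natCast_ne_top _)

instance : IsProbabilityMeasure (uniformPerm m) :=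
  isProbabilityMeasure_sum_smul (sum_inv_factorial m) _

/-- The sequence of outcomes with the given average whose order is given by a permutation. -/
def disperse (m : ℕ) (z : ℝ × Equiv.Perm (Fin m)) (i : Fin m) : ℝ :=
  if ((z.2 i : ℕ) : ℝ) < m * (1 + z.1) / 2 then 1 else -1

theorem measurable_disperse (m : ℕ) : Measurable (disperse m) := by
  refine measurable_from_prod_countable_left fun π => measurable_pi_lambda _ fun i => ?_
  refine Measurable.ite ?_ measurable_const measurable_const
  exact measurableSet_lt (f := fun _ : ℝ => ((π i : ℕ) : ℝ)) measurable_const (by fun_prop)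

/-- `disperse` puts `1` where `π i < |S|`. If `σ` carries the initial segment of length `|S|` onto
`S`, these are the `i` with `σ (π i) ∈ S`. -/
theorem exists_disperse_eq (hm : 0 < m) (S : Finset (Fin m)) : ∃ σ : Equiv.Perm (Fin m), ∀ π,
    disperse m (2 * ((S.card : ℝ) / m) - 1, π) =
      arrangement (S.map (σ * π)⁻¹.toEmbedding) := by
  have hm0 : (m : ℝ) ≠ 0 := by exact_mod_cast hm.ne'
  have hS : S.card ≤ m := by simpa using Finset.card_le_univ S
  obtain ⟨σ, hσ⟩ := Equiv.Perm.exists_map_finset_eq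
    (Finset.univ.filter fun i : Fin m => (i : ℕ) < S.card) S (by
      rw [Fin.card_filter_val_lt]
      exact min_eq_right hS)
  refine ⟨σ, fun π => funext fun i => ?_⟩
  have e : (m : ℝ) * (1 + (2 * ((S.card : ℝ) / m) - 1)) / 2 = S.card := by field_simp; ring
  have hmem : i ∈ S.map (σ * π)⁻¹.toEmbedding ↔ (π i : ℕ) < S.card := by
    have h : (σ * π)⁻¹.symm i = σ (π i) := rfl
    rw [Finset.mem_map_equiv, h]
    conv_lhs => rw [← hσ]
    rw [Finset.mem_map_equiv]
    simp
  simp only [disperse, arrangement, e, Nat.cast_lt, hmem]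

/-- The average is a sufficient statistic: dispersing it uniformly recovers the law of the
individual outcomes. -/
theorem map_disperse (hm : 0 < m) (ν : Measure ℝ) [IsProbabilityMeasure ν] {a b : ℝ≥0∞}
    (hν : ν = a • Measure.dirac 1 + b • Measure.dirac (-1)) :
    (((Measure.pi fun _ : Fin m => ν).map (fun r => (∑ i, r i) / (m : ℝ))).prod
      (uniformPerm m)).map (disperse m) = Measure.pi fun _ : Fin m => ν := by
  have hmeas : Measurable fun r : Fin m → ℝ => (∑ i, r i) / (m : ℝ) := by fun_prop
  rw [pi_two_point ν hν, map_sum_smul _ _ hmeas]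
  simp only [Measure.map_dirac' hmeas, average_arrangement hm]
  rw [sum_smul_prod, map_sum_smul _ _ (measurable_disperse m)]
  have hS : ∀ S : Finset (Fin m), ((Measure.dirac (2 * ((S.card : ℝ) / m) - 1)).prod
      (uniformPerm m)).map (disperse m) = ∑ π : Equiv.Perm (Fin m), (m.factorial : ℝ≥0∞)⁻¹ •
        Measure.dirac (arrangement (S.map π.toEmbedding)) := fun S => by
    obtain ⟨σ, hσ⟩ := exists_disperse_eq hm S
    have hd : Measurable (disperse m ∘ Prod.mk (2 * ((S.card : ℝ) / m) - 1)) :=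
      (measurable_disperse m).comp measurable_prodMk_left
    rw [Measure.dirac_prod, Measure.map_map (measurable_disperse m) measurable_prodMk_left,
      uniformPerm, map_sum_smul _ _ hd]
    simp only [Measure.map_dirac' hd, Function.comp_apply, hσ]
    -- The map `π ↦ (σ π)⁻¹` is a bijection of the group, so the auxiliary `σ`, which depends on
    -- `S`, drops out.
    exact Fintype.sum_equiv ((Equiv.mulLeft σ).trans (Equiv.inv _)) _ _ fun π => rfl
  simp only [hS, Finset.smul_sum]
  -- For a fixed permutation, relabelling the sets `S` preserves their cardinalities and hence their
  -- weights.
  rw [Finset.sum_comm]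
  have hπ : ∀ π : Equiv.Perm (Fin m), ∑ S : Finset (Fin m), (a ^ S.card * b ^ (m - S.card)) •
      (m.factorial : ℝ≥0∞)⁻¹ • Measure.dirac (arrangement (S.map π.toEmbedding)) =
      (m.factorial : ℝ≥0∞)⁻¹ • ∑ S : Finset (Fin m), (a ^ S.card * b ^ (m - S.card)) •
        Measure.dirac (arrangement S) := fun π => by
    rw [Finset.smul_sum]
    refine Fintype.sum_equiv π.finsetCongr _ _ fun S => ?_
    rw [Equiv.finsetCongr_apply, Finset.card_map, smul_comm]
  simp only [hπ]
  rw [← Finset.sum_smul, sum_inv_factorial, one_smul]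

end Sufficiency

/-! ### Rounding -/

section Rounding

/-- Rounding to the nearest point `2 k / m - 1`. -/
def roundToGrid (m : ℕ) (y : ℝ) : ℝ :=
  2 * ((⌊(m * y + m + 1) / 2⌋ : ℝ) / m) - 1

theorem measurable_roundToGrid (m : ℕ) : Measurable (roundToGrid m) := by
  have : Measurable fun y : ℝ => ⌊((m : ℝ) * y + m + 1) / 2⌋ := Int.measurable_floor.comp (by fun_prop)
  have h2 : Measurable fun y : ℝ => ((⌊((m : ℝ) * y + m + 1) / 2⌋ : ℤ) : ℝ) :=
    measurable_from_top.comp this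
  exact ((h2.div_const _).const_mul _).sub_const _

theorem roundToGrid_add {m : ℕ} (hm : 0 < m) (k : ℕ) {u : ℝ} (hu : u ∈ Set.Ico (-1 : ℝ) 1) :
    roundToGrid m (2 * ((k : ℝ) / m) - 1 + u / m) = 2 * ((k : ℝ) / m) - 1 := by
  have hm0 : (m : ℝ) ≠ 0 := by exact_mod_cast hm.ne'
  have e : ((m : ℝ) * (2 * ((k : ℝ) / m) - 1 + u / m) + m + 1) / 2 = k + (u + 1) / 2 := by
    field_simp
    ring
  have hfl : ⌊((m : ℝ) * (2 * ((k : ℝ) / m) - 1 + u / m) + m + 1) / 2⌋ = (k : ℤ) := by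
    rw [e, Int.floor_eq_iff]
    push_cast
    constructor <;> linarith [hu.1, hu.2]
  rw [roundToGrid, hfl]
  simp

theorem roundToGrid_smear {m : ℕ} (hm : 0 < m) (k : ℕ) {u : ℝ} (hu : u ∈ Set.Ico (-1 : ℝ) 1) :
    roundToGrid m (smear m (2 * ((k : ℝ) / m) - 1, u)) = 2 * ((k : ℝ) / m) - 1 := by
  rw [smear]
  split_ifs
  · simpa using roundToGrid_add hm k (u := 0) (by norm_num)
  · exact roundToGrid_add hm k hu

theorem map_roundToGrid_smear {m : ℕ} (hm : 0 < m) (θ : ℝ) :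
    (((binomialLaw m θ).prod uniformNoise).map (smear m)).map (roundToGrid m) =
      binomialLaw m θ := by
  ext A hA
  rw [Measure.map_apply (measurable_roundToGrid m) hA,
    smear_law_apply m θ (measurable_roundToGrid m hA), binomialLaw, Measure.finsetSum_apply]
  refine Finset.sum_congr rfl fun k _ => ?_
  rw [Measure.smul_apply, smul_eq_mul]
  congr 1
  have hae : ∀ᵐ u ∂uniformNoise, u ∈ Set.Ico (-1 : ℝ) 1 :=
    Measure.ae_smul_measure (ae_restrict_mem measurableSet_Ico) _
  have hset : {u | smear m (2 * ((k : ℝ) / m) - 1, u) ∈ roundToGrid m ⁻¹' A} =ᵐ[uniformNoise]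
      {_u | 2 * ((k : ℝ) / m) - 1 ∈ A} := by
    filter_upwards [hae] with u hu
    exact congrArg (· ∈ A) (roundToGrid_smear hm k hu)
  rw [measure_congr hset, Measure.dirac_apply' _ hA]
  by_cases h : 2 * ((k : ℝ) / m) - 1 ∈ A <;> simp [h]

theorem binomialLaw_zero (m : ℕ) : binomialLaw m 0 = Measure.dirac (-1) := by
  rw [binomialLaw, Finset.sum_eq_single 0]
  · simp [binomialWeight]
  · intro k _ hk
    simp [binomialWeight, hk]
  · simp

theorem binomialLaw_one {m : ℕ} (hm : 0 < m) : binomialLaw m 1 = Measure.dirac 1 := by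
  have hm0 : (m : ℝ) ≠ 0 := by exact_mod_cast hm.ne'
  rw [binomialLaw, Finset.sum_eq_single m]
  · rw [div_self hm0]
    norm_num [binomialWeight]
  · intro k hk hkm
    have : m - k ≠ 0 := by
      have := Finset.mem_range.1 hk
      omega
    simp [binomialWeight, this]
  · simp

/-- The reason for exempting the endpoints from the noise: a deterministic outcome must still match
the degenerate normal law, a point mass. -/
theorem map_smear_dirac (m : ℕ) {x : ℝ} (hx : x = 1 ∨ x = -1) :
    ((Measure.dirac x).prod uniformNoise).map (smear m) = Measure.dirac x := by
  rw [Measure.dirac_prod, Measure.map_map (measurable_smear m) measurable_prodMk_left]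
  have : smear m ∘ Prod.mk x = fun _ => x := by
    ext u
    simp [smear, hx]
  rw [this, Measure.map_const]
  simp

end Rounding

/-! ### The models for one involution -/

section OneObservable

variable {ι : Type} [Fintype ι] [DecidableEq ι] {B ρ : Matrix ι ι ℂ}

theorem outcomeProb_add (hB : B.IsHermitian) (hBB : B * B = 1) (hρ : ρ.trace = 1) :
    outcomeProb B ρ (-1) = 1 - outcomeProb B ρ 1 := by
  rw [outcomeProb_of_involution hB hBB hρ (by norm_num),
    outcomeProb_of_involution hB hBB hρ (by norm_num)]
  ring

theorem outcomeProb_one_mem (hB : B.IsHermitian) (hBB : B * B = 1) (hρ : IsDensity ρ) :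
    0 ≤ outcomeProb B ρ 1 ∧ outcomeProb B ρ 1 ≤ 1 := by
  have h := outcomeProb_nonneg hB hBB hρ.1 (x := -1) (by norm_num)
  rw [outcomeProb_add hB hBB hρ.2] at h
  exact ⟨outcomeProb_nonneg hB hBB hρ.1 (by norm_num), by linarith⟩

theorem outcomeLaw_eq (hB : B.IsHermitian) (hBB : B * B = 1) (hρ : ρ.trace = 1) :
    outcomeLaw B ρ = ENNReal.ofReal (outcomeProb B ρ 1) • Measure.dirac 1 +
      ENNReal.ofReal (1 - outcomeProb B ρ 1) • Measure.dirac (-1) := by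
  rw [outcomeLaw_of_involution hB hBB, outcomeProb_add hB hBB hρ]

theorem isProbabilityMeasure_outcomeLaw (hB : B.IsHermitian) (hBB : B * B = 1)
    (hρ : IsDensity ρ) : IsProbabilityMeasure (outcomeLaw B ρ) := by
  obtain ⟨h0, h1⟩ := outcomeProb_one_mem hB hBB hρ
  refine ⟨?_⟩
  rw [outcomeLaw_eq hB hBB hρ.2, Measure.add_apply, Measure.smul_apply, Measure.smul_apply,
    measure_univ, measure_univ, smul_eq_mul, smul_eq_mul, mul_one, mul_one,
    ← ENNReal.ofReal_add h0 (by linarith)]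
  norm_num

/-- The conditional law of the response in trace regression. -/
def traceResponse (B ρ : Matrix ι ι ℂ) (m : ℕ) : Measure ℝ :=
  gaussianReal (B * ρ).trace.re
    (Real.toNNReal (((B * B * ρ).trace.re - (B * ρ).trace.re ^ 2) / m))

instance (m : ℕ) : IsProbabilityMeasure (traceResponse B ρ m) := by
  unfold traceResponse
  infer_instance

theorem traceResponse_eq (hB : B.IsHermitian) (hBB : B * B = 1) (hρ : ρ.trace = 1) (m : ℕ) :
    traceResponse B ρ m = gaussianReal (2 * outcomeProb B ρ 1 - 1)
      (Real.toNNReal (4 * outcomeProb B ρ 1 * (1 - outcomeProb B ρ 1) / m)) := by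
  rw [traceResponse, outcomeProb_of_involution hB hBB hρ (by norm_num), hBB, one_mul, hρ,
    Complex.one_re]
  congr 2
  · ring
  · ring

/-- If `θ` is `0` or `1`, the two laws coincide. Otherwise both outcomes are proper, and the lower
bounds at `1` and at `-1` read `c ≤ θ` and `θ ≤ 1 - c`. -/
theorem exists_hasAffinity_traceResponse {c : ℝ} (hc : 0 < c) : ∃ C : ℝ, 0 < C ∧
    ∀ (ι : Type) [Fintype ι] [DecidableEq ι] (B ρ : Matrix ι ι ℂ), B.IsHermitian → B * B = 1 →
      IsDensity ρ → (∀ x ∈ properOutcomes B ρ, c ≤ outcomeProb B ρ x) → ∀ m : ℕ, 0 < m →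
      HasAffinity (((binomialLaw m (outcomeProb B ρ 1)).prod uniformNoise).map (smear m))
        (traceResponse B ρ m) (ENNReal.ofReal (1 - C / m)) := by
  obtain ⟨C, hC, h⟩ := exists_hasAffinity_smoothed_binomial hc
  refine ⟨C, hC, fun ι _ _ B ρ hB hBB hρ hc m hm => ?_⟩
  have hm0 : (0 : ℝ) < m := by exact_mod_cast hm
  obtain ⟨h0, h1⟩ := outcomeProb_one_mem hB hBB hρ
  have hmem := fun x => mem_properOutcomes hB hBB (ρ := ρ) (x := x)
  have hadd := outcomeProb_add hB hBB hρ.2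
  have hle : ENNReal.ofReal (1 - C / m) ≤ 1 := by
    rw [ENNReal.ofReal_le_one]
    have : 0 < C / m := by positivity
    linarith
  rw [traceResponse_eq hB hBB hρ.2]
  set θ := outcomeProb B ρ 1 with hθ
  rcases h0.eq_or_lt with h0 | h0
  · rw [← h0, binomialLaw_zero, map_smear_dirac m (Or.inr rfl)]
    norm_num
    exact (HasAffinity.refl _).mono hle
  rcases h1.eq_or_lt with h1 | h1
  · rw [h1, binomialLaw_one hm, map_smear_dirac m (Or.inl rfl)]
    norm_num
    exact (HasAffinity.refl _).mono hle
  · refine h m hm θ (hc 1 ((hmem 1).2 ⟨by norm_num, h0, h1⟩)) ?_ _ ?_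
    · have := hc (-1) ((hmem (-1)).2 ⟨by norm_num, by rw [hadd]; linarith, by rw [hadd]; linarith⟩)
      linarith
    · have : 0 < 1 - θ := by linarith
      exact Real.coe_toNNReal _ (by positivity)

/-- The response vector in fine scale trace regression that corresponds to a response in trace
regression. -/
def refineResponse (B : Matrix ι ι ℂ) (y : ℝ) : EuclideanSpace ℝ (outcomes B) :=
  WithLp.toLp 2 fun x => (1 + x * y) / 2

theorem measurable_refineResponse (B : Matrix ι ι ℂ) : Measurable (refineResponse B) := by
  unfold refineResponse
  fun_prop

/-- The covariance is a multiple of the rank one matrix `x y`, as it must be if the vector is to be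
an affine function of one normal variable. -/
theorem fineCov_eq (hB : B.IsHermitian) (hBB : B * B = 1) (hρ : ρ.trace = 1) (m : ℕ)
    (x y : outcomes B) :
    fineCov B ρ m x y =
      ((B * B * ρ).trace.re - (B * ρ).trace.re ^ 2) / m / 4 * ((x : ℝ) * y) := by
  have hx := sq_eq_one_of_mem_outcomes hBB x.2
  have hy := sq_eq_one_of_mem_outcomes hBB y.2
  have hpx := outcomeProb_of_involution hB hBB hρ hx
  have hpy := outcomeProb_of_involution hB hBB hρ hy
  have htr : (B * B * ρ).trace.re = 1 := by rw [hBB, one_mul, hρ, Complex.one_re]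
  rw [fineCov, Matrix.of_apply, htr]
  split_ifs with h
  · subst h
    rw [hpx, ← sq, hx]
    linear_combination (-(B * ρ).trace.re ^ 2 / (4 * m)) * hx
  · have hxy : (y : ℝ) = -x := by
      rcases sq_eq_sq_iff_eq_or_eq_neg.1 (hy.trans hx.symm) with e | e
      · exact absurd (Subtype.ext e.symm) h
      · exact e
    rw [hpx, hpy, hxy]
    linear_combination ((1 + -(B * ρ).trace.re ^ 2) / (4 * m) +
      (B * ρ).trace.re ^ 2 / (4 * m)) * hx

/-- The law may be degenerate and need not have a density, so characteristic functions are compared.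
The inner product of the refined response with `t` is affine in the scalar response. -/
theorem map_refineResponse (hB : B.IsHermitian) (hBB : B * B = 1) (hρ : IsDensity ρ) (m : ℕ) :
    (traceResponse B ρ m).map (refineResponse B) =
      multivariateGaussian (WithLp.toLp 2 fun x : outcomes B => outcomeProb B ρ x)
        (fineCov B ρ m) := by
  obtain ⟨h0, h1⟩ := outcomeProb_one_mem hB hBB hρ
  set V := ((B * B * ρ).trace.re - (B * ρ).trace.re ^ 2) / m with hV
  set μ := (B * ρ).trace.re with hμ
  have hV0 : 0 ≤ V := by
    have htr : (B * B * ρ).trace.re = 1 := by rw [hBB, one_mul, hρ.2, Complex.one_re]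
    rw [outcomeProb_of_involution hB hBB hρ.2 (by norm_num), one_mul, ← hμ] at h0 h1
    rw [hV, htr]
    refine div_nonneg ?_ (Nat.cast_nonneg _)
    nlinarith
  have hcov : ∀ x y, fineCov B ρ m x y = V / 4 * ((x : ℝ) * y) := fineCov_eq hB hBB hρ.2 m
  have hquad : ∀ t : outcomes B → ℝ, t ⬝ᵥ (fineCov B ρ m).mulVec t =
      V / 4 * (∑ x : outcomes B, (x : ℝ) * t x) ^ 2 := fun t => by
    simp only [dotProduct, Matrix.mulVec, hcov]
    rw [sq, Finset.sum_mul_sum, Finset.mul_sum]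
    refine Finset.sum_congr rfl fun x _ => ?_
    rw [Finset.mul_sum, Finset.mul_sum]
    exact Finset.sum_congr rfl fun y _ => by ring
  have hpsd : (fineCov B ρ m).PosSemidef := by
    refine Matrix.PosSemidef.of_dotProduct_mulVec_nonneg ?_ fun t => ?_
    · ext x y
      simp only [Matrix.conjTranspose_apply, hcov, star_trivial]
      ring
    · rw [star_trivial, hquad]
      positivity
  have := Measure.isProbabilityMeasure_map (μ := traceResponse B ρ m)
    (measurable_refineResponse B).aemeasurable
  refine Measure.ext_of_charFun (funext fun t => ?_)
  rw [charFun_multivariateGaussian hpsd, hquad, charFun_apply,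
    integral_map (measurable_refineResponse B).aemeasurable (by fun_prop)]
  have hinner : ∀ y, inner ℝ (refineResponse B y) t =
      (∑ x, t x) / 2 + (∑ x : outcomes B, (x : ℝ) * t x) / 2 * y := fun y => by
    simp only [refineResponse, PiLp.inner_apply, RCLike.inner_apply, conj_trivial]
    rw [Finset.sum_div, Finset.sum_div, Finset.sum_mul, ← Finset.sum_add_distrib]
    exact Finset.sum_congr rfl fun x _ => by ring
  have hmean : inner ℝ t (WithLp.toLp 2 fun x : outcomes B => outcomeProb B ρ x) =
      (∑ x, t x) / 2 + (∑ x : outcomes B, (x : ℝ) * t x) / 2 * μ := by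
    simp only [PiLp.inner_apply, RCLike.inner_apply, conj_trivial]
    rw [Finset.sum_div, Finset.sum_div, Finset.sum_mul, ← Finset.sum_add_distrib]
    refine Finset.sum_congr rfl fun x _ => ?_
    rw [outcomeProb_of_involution hB hBB hρ.2 (sq_eq_one_of_mem_outcomes hBB x.2), ← hμ]
    ring
  have hchar := charFun_gaussianReal (μ := μ) (v := Real.toNNReal V) ((∑ x : outcomes B, (x : ℝ) * t x) / 2)
  rw [charFun_apply_real] at hchar
  simp only [hinner]
  have e : ∀ y : ℝ, Complex.exp ((((∑ x, t x) / 2 + (∑ x : outcomes B, (x : ℝ) * t x) / 2 * y : ℝ) : ℂ) *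
      Complex.I) = Complex.exp ((((∑ x, t x) / 2 : ℝ) : ℂ) * Complex.I) *
        Complex.exp ((((∑ x : outcomes B, (x : ℝ) * t x) / 2 : ℝ) : ℂ) * y * Complex.I) := fun y => by
    rw [← Complex.exp_add]
    congr 1
    push_cast
    ring
  simp only [e]
  rw [integral_const_mul, traceResponse, ← hV, ← hμ, hchar, ← Complex.exp_add, hmean,
    Real.coe_toNNReal _ hV0]
  congr 1
  push_cast
  ring

/-- The response in trace regression that corresponds to a response vector in fine scale trace
regression. -/
def coarsenResponse (B : Matrix ι ι ℂ) (x : outcomes B) (y : EuclideanSpace ℝ (outcomes B)) : ℝ :=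
  x * (2 * y x - 1)

theorem measurable_coarsenResponse (B : Matrix ι ι ℂ) (x : outcomes B) :
    Measurable (coarsenResponse B x) := by
  unfold coarsenResponse
  fun_prop

theorem coarsenResponse_refineResponse (hBB : B * B = 1) (x : outcomes B) (y : ℝ) :
    coarsenResponse B x (refineResponse B y) = y := by
  have hx := sq_eq_one_of_mem_outcomes hBB x.2
  simp only [coarsenResponse, refineResponse]
  linear_combination y * hx

/-- The probabilities of `1` and `-1` add up to one, so they cannot both vanish. An outcome is
needed because the scalar response is read off from one coordinate of the fine scale vector. -/
theorem exists_mem_outcomes (hB : B.IsHermitian) (hBB : B * B = 1) (hρ : ρ.trace = 1) :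
    Nonempty (outcomes B) := by
  by_contra h
  have hn : ∀ x, x ∉ outcomes B := fun x hx => h ⟨⟨x, hx⟩⟩
  have hadd := outcomeProb_add hB hBB hρ
  rw [outcomeProb_eq_zero_of_notMem hB hBB (by norm_num) (hn _),
    outcomeProb_eq_zero_of_notMem hB hBB (by norm_num) (hn _)] at hadd
  norm_num at hadd

end OneObservable

/-! ### Simulation of one experiment by another -/

section Simulation

variable {T X Y Z : Type} [MeasurableSpace X] [MeasurableSpace Y] [MeasurableSpace Z]

/-- Some Markov kernel maps the laws in `P` to laws that overlap with those in `Q` up to `ε`. -/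
def Simulates (P : T → Measure X) (Q : T → Measure Y) (ε : ℝ) : Prop :=
  ∃ κ : Kernel X Y, IsMarkovKernel κ ∧ ∀ t, Overlaps (κ ∘ₘ P t) (Q t) ε

theorem Simulates.deficiency_le {P : T → Measure X} {Q : T → Measure Y} {ε : ℝ}
    (h : Simulates P Q ε) (hP : ∀ t, IsProbabilityMeasure (P t))
    (hQ : ∀ t, IsProbabilityMeasure (Q t)) : deficiency P Q ≤ ENNReal.ofReal ε := by
  obtain ⟨κ, hκ, h⟩ := h
  exact Tomography.deficiency_le κ h

theorem Simulates.comp_left {P : T → Measure X} {Q : T → Measure Y} {R : T → Measure Z} {ε : ℝ}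
    (h : Simulates Q R ε) {κ : Kernel X Y} (hκ : IsMarkovKernel κ) (hPQ : ∀ t, κ ∘ₘ P t = Q t) :
    Simulates P R ε := by
  obtain ⟨η, hη, h⟩ := h
  refine ⟨η ∘ₖ κ, inferInstance, fun t => ?_⟩
  rw [← Measure.comp_assoc, hPQ]
  exact h t

theorem Simulates.comp_right {P : T → Measure X} {Q : T → Measure Y} {R : T → Measure Z} {ε : ℝ}
    (h : Simulates P Q ε) {κ : Kernel Y Z} (hκ : IsMarkovKernel κ) (hQR : ∀ t, κ ∘ₘ Q t = R t) :
    Simulates P R ε := by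
  obtain ⟨η, hη, h⟩ := h
  refine ⟨κ ∘ₖ η, inferInstance, fun t => ?_⟩
  rw [← Measure.comp_assoc, ← hQR]
  exact (h t).comp κ

end Simulation

/-! ### Mixtures and maps on disjoint unions -/

section Mixture

variable {J : Type*} {Z : J → Type*} [∀ j, MeasurableSpace (Z j)] {X : Type*} [MeasurableSpace X]

theorem isProbabilityMeasure_mixture [Fintype J] (w : PMF J) (P : ∀ j, Measure (Z j))
    [∀ j, IsProbabilityMeasure (P j)] {e : ∀ j, Z j → X} (he : ∀ j, Measurable (e j)) :
    IsProbabilityMeasure (∑ j, w j • (P j).map (e j)) := by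
  have : ∀ j, IsProbabilityMeasure ((P j).map (e j)) := fun j =>
    Measure.isProbabilityMeasure_map (he j).aemeasurable
  exact isProbabilityMeasure_sum_smul (sum_pmf w) _

theorem measurable_sigmaMk (j : J) : Measurable (Sigma.mk (β := Z) j) :=
  measurable_iff_le_map.2 (iInf_le _ j)

theorem measurable_of_comp_sigmaMk {F : (Σ j, Z j) → X}
    (hF : ∀ j, Measurable fun x => F ⟨j, x⟩) : Measurable F := fun _ hs =>
  MeasurableSpace.measurableSet_iInf.2 fun j => hF j hs

end Mixture

/-! ### The experiments for a family of involutions -/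

section Family

variable {ι J : Type} [Fintype ι] [DecidableEq ι] [Fintype J] [MeasurableSpace J]

/-- The law of one observation in trace regression. -/
def traceCopy (B : J → Matrix ι ι ℂ) (w : PMF J) (m : ℕ) (ρ : Matrix ι ι ℂ) : Measure (J × ℝ) :=
  ∑ j, w j • (traceResponse (B j) ρ m).map (Prod.mk j)

/-- The law of one observation in tomography with summarized measurements. -/
def summarizedCopy (B : J → Matrix ι ι ℂ) (w : PMF J) (m : ℕ) (ρ : Matrix ι ι ℂ) :
    Measure (J × ℝ) :=
  ∑ j, w j • ((Measure.pi fun _ : Fin m => outcomeLaw (B j) ρ).map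
    fun r : Fin m → ℝ => (∑ i, r i) / (m : ℝ)).map (Prod.mk j)

/-- The law of one observation in fine scale trace regression. -/
def fineCopy (B : J → Matrix ι ι ℂ) (w : PMF J) (m : ℕ) (ρ : Matrix ι ι ℂ) :
    Measure (Σ j : J, EuclideanSpace ℝ (outcomes (B j))) :=
  ∑ j, w j • (multivariateGaussian (WithLp.toLp 2 fun x : outcomes (B j) => outcomeProb (B j) ρ x)
    (fineCov (B j) ρ m)).map (Sigma.mk (β := fun j : J => EuclideanSpace ℝ (outcomes (B j))) j)

/-- The law of one observation in tomography with individual measurements. -/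
def individualCopy (B : J → Matrix ι ι ℂ) (w : PMF J) (m : ℕ) (ρ : Matrix ι ι ℂ) :
    Measure (J × (Fin m → ℝ)) :=
  ∑ j, w j • (Measure.pi fun _ : Fin m => outcomeLaw (B j) ρ).map (Prod.mk j)

/-- The law of one smeared observation in tomography with summarized measurements. -/
def smearedCopy (B : J → Matrix ι ι ℂ) (w : PMF J) (m : ℕ) (ρ : Matrix ι ι ℂ) :
    Measure (J × ℝ) :=
  ∑ j, w j • (((binomialLaw m (outcomeProb (B j) ρ 1)).prod uniformNoise).map (smear m)).map
    (Prod.mk j)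

instance isProbabilityMeasure_traceCopy (B : J → Matrix ι ι ℂ) (w : PMF J) (m : ℕ)
    (ρ : Matrix ι ι ℂ) : IsProbabilityMeasure (traceCopy B w m ρ) :=
  isProbabilityMeasure_mixture w _ fun _ => measurable_prodMk_left

instance isProbabilityMeasure_fineCopy (B : J → Matrix ι ι ℂ) (w : PMF J) (m : ℕ)
    (ρ : Matrix ι ι ℂ) : IsProbabilityMeasure (fineCopy B w m ρ) :=
  isProbabilityMeasure_mixture w _ fun j => measurable_sigmaMk j

/-- The members of the family are Hermitian involutions. -/
structure IsInvolutionFamily (B : J → Matrix ι ι ℂ) : Prop where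
  /-- every member is Hermitian -/
  isHermitian : ∀ j, (B j).IsHermitian
  /-- every member squares to the identity -/
  mul_self : ∀ j, B j * B j = 1

variable {B : J → Matrix ι ι ℂ} {ρ : Matrix ι ι ℂ} {m : ℕ}

theorem isProbabilityMeasure_individualCopy (hB : IsInvolutionFamily B) (w : PMF J)
    (hρ : IsDensity ρ) (m : ℕ) : IsProbabilityMeasure (individualCopy B w m ρ) := by
  have := fun j => isProbabilityMeasure_outcomeLaw (hB.isHermitian j) (hB.mul_self j) hρ
  exact isProbabilityMeasure_mixture w _ fun _ => measurable_prodMk_left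

theorem isProbabilityMeasure_summarizedCopy (hB : IsInvolutionFamily B) (w : PMF J)
    (hρ : IsDensity ρ) (m : ℕ) : IsProbabilityMeasure (summarizedCopy B w m ρ) := by
  have := fun j => isProbabilityMeasure_outcomeLaw (hB.isHermitian j) (hB.mul_self j) hρ
  have hm : Measurable fun r : Fin m → ℝ => (∑ i, r i) / (m : ℝ) := by fun_prop
  have := fun j => Measure.isProbabilityMeasure_map
    (μ := Measure.pi fun _ : Fin m => outcomeLaw (B j) ρ) hm.aemeasurable
  exact isProbabilityMeasure_mixture w _ fun _ => measurable_prodMk_left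

theorem isProbabilityMeasure_smearedCopy (hB : IsInvolutionFamily B) (w : PMF J)
    (hρ : IsDensity ρ) (m : ℕ) : IsProbabilityMeasure (smearedCopy B w m ρ) := by
  have := fun j =>
    have h := outcomeProb_one_mem (hB.isHermitian j) (hB.mul_self j) hρ
    isProbabilityMeasure_binomialLaw h.1 h.2 m
  have := fun j => Measure.isProbabilityMeasure_map
    (μ := (binomialLaw m (outcomeProb (B j) ρ 1)).prod uniformNoise)
    (measurable_smear m).aemeasurable
  exact isProbabilityMeasure_mixture w _ fun _ => measurable_prodMk_left

theorem summarizedCopy_eq (hB : IsInvolutionFamily B) (w : PMF J) (hρ : IsDensity ρ) (hm : 0 < m) :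
    summarizedCopy B w m ρ =
      ∑ j, w j • (binomialLaw m (outcomeProb (B j) ρ 1)).map (Prod.mk j) := by
  refine Finset.sum_congr rfl fun j _ => ?_
  have := isProbabilityMeasure_outcomeLaw (hB.isHermitian j) (hB.mul_self j) hρ
  have h := outcomeProb_one_mem (hB.isHermitian j) (hB.mul_self j) hρ
  rw [map_average_pi_two_point hm _ h.1 h.2 (outcomeLaw_eq (hB.isHermitian j) (hB.mul_self j) hρ.2)]

/-- As in the companion lemmas below, the order of quantifiers is essential: one kernel serves all
states, since the noise does not involve `ρ`. -/
theorem exists_kernel_smear (hB : IsInvolutionFamily B) (w : PMF J) (hm : 0 < m) (n : ℕ) :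
    ∃ κ : Kernel (Fin n → J × ℝ) (Fin n → J × ℝ), IsMarkovKernel κ ∧ ∀ ρ, IsDensity ρ →
      κ ∘ₘ (Measure.pi fun _ => summarizedCopy B w m ρ) =
        Measure.pi fun _ => smearedCopy B w m ρ := by
  have hF : Measurable fun z : (J × ℝ) × ℝ => (z.1.1, smear m (z.1.2, z.2)) :=
    (measurable_fst.comp measurable_fst).prodMk
      ((measurable_smear m).comp (measurable_snd.comp measurable_fst |>.prodMk measurable_snd))
  obtain ⟨κ, hκ, h⟩ := exists_kernel_pi_prod_map uniformNoise hF n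
  refine ⟨κ, hκ, fun ρ hρ => ?_⟩
  have := isProbabilityMeasure_summarizedCopy hB w hρ m
  have := fun j =>
    have h := outcomeProb_one_mem (hB.isHermitian j) (hB.mul_self j) hρ
    isProbabilityMeasure_binomialLaw h.1 h.2 m
  rw [h, summarizedCopy_eq hB w hρ hm, smearedCopy, prod_map_mixture uniformNoise
    (e := fun j => Prod.mk j) (e' := fun j => Prod.mk j) (G := fun _ => smear m) (fun _ => measurable_prodMk_left)
    (fun _ => measurable_prodMk_left) hF
    (fun _ => measurable_smear m) fun _ _ _ => rfl]

theorem exists_kernel_round (hB : IsInvolutionFamily B) (w : PMF J) (hm : 0 < m) (n : ℕ) :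
    ∃ κ : Kernel (Fin n → J × ℝ) (Fin n → J × ℝ), IsMarkovKernel κ ∧ ∀ ρ, IsDensity ρ →
      κ ∘ₘ (Measure.pi fun _ => smearedCopy B w m ρ) =
        Measure.pi fun _ => summarizedCopy B w m ρ := by
  have hF : Measurable fun z : J × ℝ => (z.1, roundToGrid m z.2) :=
    measurable_fst.prodMk ((measurable_roundToGrid m).comp measurable_snd)
  obtain ⟨κ, hκ, h⟩ := exists_kernel_pi_map hF n
  refine ⟨κ, hκ, fun ρ hρ => ?_⟩
  have := isProbabilityMeasure_smearedCopy hB w hρ m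
  rw [h, summarizedCopy_eq hB w hρ hm, smearedCopy, map_mixture
    (e := fun j => Prod.mk j) (e' := fun j => Prod.mk j) (G := fun _ => roundToGrid m) (fun _ => measurable_prodMk_left)
    (fun _ => measurable_prodMk_left) hF
    (fun _ => measurable_roundToGrid m) fun _ _ => rfl]
  simp only [map_roundToGrid_smear hm]

theorem exists_kernel_average (hB : IsInvolutionFamily B) (w : PMF J) (m n : ℕ) :
    ∃ κ : Kernel (Fin n → J × (Fin m → ℝ)) (Fin n → J × ℝ), IsMarkovKernel κ ∧
      ∀ ρ, IsDensity ρ → κ ∘ₘ (Measure.pi fun _ => individualCopy B w m ρ) =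
        Measure.pi fun _ => summarizedCopy B w m ρ := by
  have hm : Measurable fun r : Fin m → ℝ => (∑ i, r i) / (m : ℝ) := by fun_prop
  have hF : Measurable fun z : J × (Fin m → ℝ) => (z.1, (∑ i, z.2 i) / (m : ℝ)) :=
    measurable_fst.prodMk (hm.comp measurable_snd)
  obtain ⟨κ, hκ, h⟩ := exists_kernel_pi_map hF n
  refine ⟨κ, hκ, fun ρ hρ => ?_⟩
  have := isProbabilityMeasure_individualCopy hB w hρ m
  rw [h, summarizedCopy, individualCopy, map_mixture
    (e := fun j => Prod.mk j) (e' := fun j => Prod.mk j)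
    (G := fun _ r => (∑ i, r i) / (m : ℝ)) (fun _ => measurable_prodMk_left)
    (fun _ => measurable_prodMk_left) hF
    (fun _ => hm) fun _ _ => rfl]

theorem exists_kernel_disperse (hB : IsInvolutionFamily B) (w : PMF J) (hm : 0 < m) (n : ℕ) :
    ∃ κ : Kernel (Fin n → J × ℝ) (Fin n → J × (Fin m → ℝ)), IsMarkovKernel κ ∧
      ∀ ρ, IsDensity ρ → κ ∘ₘ (Measure.pi fun _ => summarizedCopy B w m ρ) =
        Measure.pi fun _ => individualCopy B w m ρ := by
  have hF : Measurable fun z : (J × ℝ) × Equiv.Perm (Fin m) =>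
      (z.1.1, disperse m (z.1.2, z.2)) :=
    (measurable_fst.comp measurable_fst).prodMk
      ((measurable_disperse m).comp (measurable_snd.comp measurable_fst |>.prodMk measurable_snd))
  obtain ⟨κ, hκ, h⟩ := exists_kernel_pi_prod_map (uniformPerm m) hF n
  refine ⟨κ, hκ, fun ρ hρ => ?_⟩
  have := isProbabilityMeasure_summarizedCopy hB w hρ m
  have := fun j => isProbabilityMeasure_outcomeLaw (hB.isHermitian j) (hB.mul_self j) hρ
  have hav : Measurable fun r : Fin m → ℝ => (∑ i, r i) / (m : ℝ) := by fun_prop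
  have := fun j => Measure.isProbabilityMeasure_map
    (μ := Measure.pi fun _ : Fin m => outcomeLaw (B j) ρ) hav.aemeasurable
  rw [h, summarizedCopy, individualCopy, prod_map_mixture (uniformPerm m)
    (e := fun j => Prod.mk j) (e' := fun j => Prod.mk j) (G := fun _ => disperse m) (fun _ => measurable_prodMk_left)
    (fun _ => measurable_prodMk_left) hF
    (fun _ => measurable_disperse m) fun _ _ _ => rfl]
  simp only [map_disperse hm _ (outcomeLaw_eq (hB.isHermitian _) (hB.mul_self _) hρ.2)]

theorem exists_kernel_coarsen (hB : IsInvolutionFamily B) (w : PMF J) (m n : ℕ)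
    (hne : ∀ j, Nonempty (outcomes (B j))) :
    ∃ κ : Kernel (Fin n → Σ j : J, EuclideanSpace ℝ (outcomes (B j))) (Fin n → J × ℝ),
      IsMarkovKernel κ ∧ ∀ ρ, IsDensity ρ → κ ∘ₘ (Measure.pi fun _ => fineCopy B w m ρ) =
        Measure.pi fun _ => traceCopy B w m ρ := by
  have hF : Measurable fun z : (Σ j : J, EuclideanSpace ℝ (outcomes (B j))) =>
      (z.1, coarsenResponse (B z.1) (hne z.1).some z.2) :=
    measurable_of_comp_sigmaMk fun j =>
      show Measurable fun x => (j, coarsenResponse (B j) (hne j).some x) from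
        measurable_const.prodMk (measurable_coarsenResponse (B j) _)
  obtain ⟨κ, hκ, h⟩ := exists_kernel_pi_map hF n
  refine ⟨κ, hκ, fun ρ hρ => ?_⟩
  rw [h, fineCopy, traceCopy, map_mixture (e := fun j => Sigma.mk j) (e' := fun j => Prod.mk j)
    (G := fun j => coarsenResponse (B j) (hne j).some) (fun j => measurable_sigmaMk j)
    (fun _ => measurable_prodMk_left) hF (fun j => measurable_coarsenResponse (B j) _)
    fun _ _ => rfl]
  have hinv : ∀ j, (multivariateGaussian
      (WithLp.toLp 2 fun x : outcomes (B j) => outcomeProb (B j) ρ x) (fineCov (B j) ρ m)).map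
        (coarsenResponse (B j) (hne j).some) = traceResponse (B j) ρ m := fun j => by
    rw [← map_refineResponse (hB.isHermitian j) (hB.mul_self j) hρ,
      Measure.map_map (measurable_coarsenResponse (B j) _) (measurable_refineResponse (B j))]
    have : coarsenResponse (B j) (hne j).some ∘ refineResponse (B j) = id :=
      funext fun y => coarsenResponse_refineResponse (hB.mul_self j) _ y
    rw [this, Measure.map_id]
  simp only [hinv]

variable [MeasurableSingletonClass J]

theorem exists_kernel_refine (hB : IsInvolutionFamily B) (w : PMF J) (m n : ℕ) :
    ∃ κ : Kernel (Fin n → J × ℝ) (Fin n → Σ j : J, EuclideanSpace ℝ (outcomes (B j))),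
      IsMarkovKernel κ ∧ ∀ ρ, IsDensity ρ → κ ∘ₘ (Measure.pi fun _ => traceCopy B w m ρ) =
        Measure.pi fun _ => fineCopy B w m ρ := by
  have hF : Measurable fun z : J × ℝ => (⟨z.1, refineResponse (B z.1) z.2⟩ :
      Σ j : J, EuclideanSpace ℝ (outcomes (B j))) :=
    measurable_from_prod_countable_right fun j =>
      (measurable_sigmaMk (Z := fun j => EuclideanSpace ℝ (outcomes (B j))) j).comp
        (measurable_refineResponse (B j))
  obtain ⟨κ, hκ, h⟩ := exists_kernel_pi_map hF n
  refine ⟨κ, hκ, fun ρ hρ => ?_⟩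
  rw [h, traceCopy, fineCopy, map_mixture
    (e := fun j => Prod.mk j) (e' := fun j => Sigma.mk j) (G := fun j => refineResponse (B j))
    (fun _ => measurable_prodMk_left) (fun j => measurable_sigmaMk j) hF
    (fun j => measurable_refineResponse (B j)) fun _ _ => rfl]
  simp only [map_refineResponse (hB.isHermitian _) (hB.mul_self _) hρ]

theorem overlaps_smearedCopy_traceCopy {C : ℝ} (hB : IsInvolutionFamily B) (w : PMF J)
    (hρ : IsDensity ρ) (m n : ℕ)
    (h : ∀ j, HasAffinity
      (((binomialLaw m (outcomeProb (B j) ρ 1)).prod uniformNoise).map (smear m))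
      (traceResponse (B j) ρ m) (ENNReal.ofReal (1 - C / m))) :
    Overlaps (Measure.pi fun _ : Fin n => smearedCopy B w m ρ)
      (Measure.pi fun _ : Fin n => traceCopy B w m ρ) (√(2 * n * (C / m))) := by
  have := isProbabilityMeasure_smearedCopy hB w hρ m
  have haff : HasAffinity (smearedCopy B w m ρ) (traceCopy B w m ρ)
      (ENNReal.ofReal (1 - C / m)) := HasAffinity.sum (fun j => w j) (sum_pmf w) h
  exact haff.overlaps_pi n

/-- The deficiency bounds for a family of involutions and an arbitrary sampling distribution. -/
theorem exists_deficiencyDist_le {c : ℝ} (hc : 0 < c) : ∃ C : ℝ, 0 < C ∧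
    ∀ (ι J : Type) [Fintype ι] [DecidableEq ι] [Fintype J] [MeasurableSpace J]
      [MeasurableSingletonClass J] (B : J → Matrix ι ι ℂ), IsInvolutionFamily B →
      (∀ j, Nonempty (outcomes (B j))) → ∀ (w : PMF J) (n m : ℕ), 0 < m →
      ∀ Θ : Set (Matrix ι ι ℂ), (∀ ρ ∈ Θ, IsDensity ρ) →
        (∀ ρ ∈ Θ, ∀ j, ∀ x ∈ properOutcomes (B j) ρ, c ≤ outcomeProb (B j) ρ x) →
        deficiencyDist (fun ρ : Θ => traceRegression B w n m ρ.1)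
            (fun ρ : Θ => tomographySummarized B w n m ρ.1) ≤
          ENNReal.ofReal (C * √((n : ℝ) / m)) ∧
        deficiencyDist (fun ρ : Θ => fineTraceRegression B w n m ρ.1)
            (fun ρ : Θ => tomographyIndividual B w n m ρ.1) ≤
          ENNReal.ofReal (C * √((n : ℝ) / m)) := by
  obtain ⟨C, hC, haff⟩ := exists_hasAffinity_traceResponse hc
  -- From `√(2 n C / m) = √(2 C) * √(n / m)`, the bound of `HasAffinity.overlaps_pi` with `h = C /
  -- m`.
  refine ⟨√(2 * C), by positivity, ?_⟩
  intro ι J _ _ _ _ _ B hB hne w n m hm Θ hΘ hprob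
  have hρ : ∀ ρ : Θ, IsDensity ρ.1 := fun ρ => hΘ ρ.1 ρ.2
  have hε : √(2 * C) * √((n : ℝ) / m) = √(2 * n * (C / m)) := by
    rw [← Real.sqrt_mul (by positivity)]
    congr 1
    ring
  rw [hε]
  have hov : ∀ ρ : Θ, Overlaps (Measure.pi fun _ : Fin n => smearedCopy B w m ρ.1)
      (Measure.pi fun _ : Fin n => traceCopy B w m ρ.1) (√(2 * n * (C / m))) := fun ρ =>
    overlaps_smearedCopy_traceCopy hB w (hρ ρ) m n fun j =>
      haff ι (B j) ρ.1 (hB.isHermitian j) (hB.mul_self j) (hρ ρ) (hprob ρ.1 ρ.2 j) m hm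
  have hpT : ∀ ρ : Θ, IsProbabilityMeasure (traceRegression B w n m ρ.1) := fun ρ =>
    inferInstanceAs (IsProbabilityMeasure (Measure.pi fun _ => traceCopy B w m ρ.1))
  have hpF : ∀ ρ : Θ, IsProbabilityMeasure (fineTraceRegression B w n m ρ.1) := fun ρ =>
    inferInstanceAs (IsProbabilityMeasure (Measure.pi fun _ => fineCopy B w m ρ.1))
  have hpS : ∀ ρ : Θ, IsProbabilityMeasure (tomographySummarized B w n m ρ.1) := fun ρ =>
    have := isProbabilityMeasure_summarizedCopy hB w (hρ ρ) m
    inferInstanceAs (IsProbabilityMeasure (Measure.pi fun _ => summarizedCopy B w m ρ.1))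
  have hpI : ∀ ρ : Θ, IsProbabilityMeasure (tomographyIndividual B w n m ρ.1) := fun ρ =>
    have := isProbabilityMeasure_individualCopy hB w (hρ ρ) m
    inferInstanceAs (IsProbabilityMeasure (Measure.pi fun _ => individualCopy B w m ρ.1))
  obtain ⟨κs, hκs, hs⟩ := exists_kernel_smear hB w hm n
  obtain ⟨κr, hκr, hr⟩ := exists_kernel_round hB w hm n
  obtain ⟨κa, hκa, ha⟩ := exists_kernel_average hB w m n
  obtain ⟨κd, hκd, hd⟩ := exists_kernel_disperse hB w hm n
  obtain ⟨κf, hκf, hf⟩ := exists_kernel_refine hB w m n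
  obtain ⟨κc, hκc, hcs⟩ := exists_kernel_coarsen hB w m n hne
  have hST : Simulates (fun ρ : Θ => tomographySummarized B w n m ρ.1)
      (fun ρ : Θ => traceRegression B w n m ρ.1) (√(2 * n * (C / m))) :=
    ⟨κs, hκs, fun ρ => (congrArg (Overlaps · _ _) (hs ρ.1 (hρ ρ))).mpr (hov ρ)⟩
  have hTS : Simulates (fun ρ : Θ => traceRegression B w n m ρ.1)
      (fun ρ : Θ => tomographySummarized B w n m ρ.1) (√(2 * n * (C / m))) :=
    ⟨κr, hκr, fun ρ => (congrArg (Overlaps _ · _) (hr ρ.1 (hρ ρ))).mp ((hov ρ).symm.comp κr)⟩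
  -- Averaging and refining are exact at the two ends, so the error is that of the coarse pair; the
  -- reverse direction uses coarsening and dispersing.
  have hIF : Simulates (fun ρ : Θ => tomographyIndividual B w n m ρ.1)
      (fun ρ : Θ => fineTraceRegression B w n m ρ.1) (√(2 * n * (C / m))) :=
    (hST.comp_left hκa fun ρ => ha ρ.1 (hρ ρ)).comp_right hκf fun ρ => hf ρ.1 (hρ ρ)
  have hFI : Simulates (fun ρ : Θ => fineTraceRegression B w n m ρ.1)
      (fun ρ : Θ => tomographyIndividual B w n m ρ.1) (√(2 * n * (C / m))) :=
    (hTS.comp_left hκc fun ρ => hcs ρ.1 (hρ ρ)).comp_right hκd fun ρ => hd ρ.1 (hρ ρ)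
  exact ⟨max_le (hTS.deficiency_le hpT hpS) (hST.deficiency_le hpS hpT),
    max_le (hFI.deficiency_le hpF hpI) (hIF.deficiency_le hpI hpF)⟩

end Family

theorem isInvolutionFamily_pauli (b : ℕ) : IsInvolutionFamily (pauli b) :=
  ⟨isHermitian_pauli b, pauli_mul_self b⟩

theorem nonempty_outcomes_pauli (b : ℕ) (l : PauliIndex b) : Nonempty (outcomes (pauli b l)) :=
  exists_mem_outcomes (isHermitian_pauli b l) (pauli_mul_self b l)
    (maximallyMixed_mem (b := b) le_rfl).1.2

end Tomography

end

theorem corollary2 :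
    (∀ b s : ℕ, 1 ≤ s →
      IsGreatest
        ((fun ρ => (1 / (4 : ℝ) ^ b) *
          ∑ l : PauliIndex b, if 2 ≤ (properOutcomes (pauli b l) ρ).card then (1 : ℝ) else 0) ''
            sparsePauli b s)
        (zeta (sparsePauli b s) (pauli b)
          (PMF.uniformOfFintype (PauliIndex b)) (PMF.uniformOfFintype (PauliIndex b))) ∧
      zeta (sparsePauli b s) (pauli b)
          (PMF.uniformOfFintype (PauliIndex b)) (PMF.uniformOfFintype (PauliIndex b)) ≤ 1 ∧
      1 - 1 / (4 : ℝ) ^ b ≤ zeta (sparsePauli b s) (pauli b)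
          (PMF.uniformOfFintype (PauliIndex b)) (PMF.uniformOfFintype (PauliIndex b))) ∧
    (∀ c₀ c₁ : ℝ, 0 < c₀ → c₀ ≤ c₁ → c₁ < 1 →
      ∃ C : ℝ, 0 < C ∧
        ∀ (b s n m : ℕ), 0 < m →
          ∀ Θ : Set (Matrix (QubitIndex b) (QubitIndex b) ℂ), Θ ⊆ sparsePauli b s →
            ProbsBounded Θ (pauli b) c₀ c₁ →
              deficiencyDist
                  (fun ρ : Θ => traceRegression (pauli b)
                    (PMF.uniformOfFintype (PauliIndex b)) n m ρ.1)
                  (fun ρ : Θ => tomographySummarized (pauli b)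
                    (PMF.uniformOfFintype (PauliIndex b)) n m ρ.1)
                ≤ ENNReal.ofReal (C * Real.sqrt ((n : ℝ) / m)) ∧
              deficiencyDist
                  (fun ρ : Θ => fineTraceRegression (pauli b)
                    (PMF.uniformOfFintype (PauliIndex b)) n m ρ.1)
                  (fun ρ : Θ => tomographyIndividual (pauli b)
                    (PMF.uniformOfFintype (PauliIndex b)) n m ρ.1)
                ≤ ENNReal.ofReal (C * Real.sqrt ((n : ℝ) / m))) := by
  refine ⟨fun b s hs => ⟨isGreatest_zeta hs, ?_, ?_⟩, fun c₀ c₁ h₀ _ _ => ?_⟩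
  · obtain ⟨ρ, -, hρ⟩ := (isGreatest_zeta (b := b) hs).1
    rw [← hρ]
    exact properFraction_le_one b ρ
  · exact (le_properFraction_maximallyMixed b).trans
      ((isGreatest_zeta hs).2 ⟨_, maximallyMixed_mem hs, rfl⟩)
  · obtain ⟨C, hC, h⟩ := exists_deficiencyDist_le h₀
    exact ⟨C, hC, fun b s n m hm Θ hΘ hprob => h _ _ (pauli b) (isInvolutionFamily_pauli b)
      (nonempty_outcomes_pauli b) _ n m hm Θ (fun ρ hρ => (hΘ hρ).1)
      fun ρ hρ j x hx => (hprob ρ hρ j x hx).1⟩
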